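/- **Setting.** Let $g_1,\dots,g_d$ be linearly independent, pairwise commuting smooth (i.e. holomorphic) vector fields on $\mathbb{C}^D$, and for $u\in\mathbb{C}^d$ put $g^u=\sum_j u_jg_j$. Every $g^u$ is assumed complete (its integral curves exist for all real times), and $\varphi_u:\mathbb{C}^D\to\mathbb{C}^D$ denotes its flow at time $1$. Let $A$ be a countable commutative monoid, written additively with neutral element $\mathbf 0$, whose elements are called letters, let $f_\ell:\mathbb{C}^D\to\mathbb{C}^D$, $\ell\in A$, be smooth (holomorphic) vector fields, and let $\nu_{j,\ell}\in\mathbb{C}$ be such that, for all $j$ and all $\ell,\ell'\in A$, $$[g_j,f_\ell]=\nu_{j,\ell}\,f_\ell,\qquad \nu_{j,\ell+\ell'}=\nu_{j,\ell}+\nu_{j,\ell'},$$ where $[g,f]=f'g-g'f$. Write $\nu^u_\ell=\sum_j u_j\nu_{j,\ell}$, and let $v\in\mathbb{C}^d$ be non-resonant: $\nu^v_\ell=0$ if and only if $\ell=\mathbf 0$. **Coefficients.** For $\tau\in\mathbb{R}$ and $u\in\mathbb{C}^d$ define numbers $\gamma_w=\gamma_w(\tau,u)$, for all words $w$ with letters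 in $A$, recursively by $\gamma_\emptyset=1$ and, for $r\ge1$, $\ell_0\in A\setminus\{\mathbf 0\}$, $n\geq 1$ and $\ell_1,\dots,\ell_n\in A$, $$\gamma_{\ell_0}=\frac{\exp(\nu^u_{\ell_0})-1}{\nu^v_{\ell_0}},\qquad \gamma_{\mathbf 0^r}=\frac{\tau^r}{r!},\qquad \gamma_{\mathbf 0^r\ell_0}=\frac{\gamma_{\mathbf 0^r}\exp(\nu^u_{\ell_0})-\gamma_{\mathbf 0^{r-1}\ell_0}}{\nu^v_{\ell_0}},$$ $$\gamma_{\ell_0\ell_1\cdots\ell_n}=\frac{\gamma_{(\ell_0+\ell_1)\ell_2\cdots\ell_n}-\gamma_{\ell_1\cdots\ell_n}}{\nu^v_{\ell_0}},\qquad \gamma_{\mathbf 0^r\ell_0\ell_1\cdots\ell_n}=\frac{\gamma_{\mathbf 0^r(\ell_0+\ell_1)\ell_2\cdots\ell_n}-\gamma_{\mathbf 0^{r-1}\ell_0\ell_1\cdots\ell_n}}{\nu^v_{\ell_0}}.$$ **Formal series.** Let $f_\emptyset=\mathrm{id}$ and $f_{\ell_1\cdots\ell_n}(x)=f'_{\ell_2\cdots\ell_n}(x)f_{\ell_1}(x)$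 for $n>1$. The word series $W_\delta(x)=\sum_w\delta_wf_w(x)$ is a formal series of maps: a commuting bookkeeping indeterminate $\varepsilon_\ell$ is attached to each letter $\ell$, and the word $w=\ell_1\cdots\ell_n$ contributes $\delta_wf_w(x)$ to the coefficient of $\varepsilon_{\ell_1}\cdots\varepsilon_{\ell_n}$ (a finite sum for each monomial). A formal series $F=\sum_m\varepsilon^mF_m$ with smooth coefficient maps $F_m:\mathbb{C}^D\to\mathbb{C}^D$ is composed with a formal series $G=\sum_m\varepsilon^mG_m$ by Taylor expansion of each $F_m$ at $G_0(x)$: $$(F\circ G)(x)=\sum_m\varepsilon^m\sum_{k\ge0}\frac1{k!}\,D^kF_m(G_0(x))[\eta,\dots,\eta],\qquad \eta=\sum_{q\ne0}\varepsilon^qG_q(x),$$ an ordinary map being regarded as a series with a term of degree $0$ only. **Theorem.** For $\tau\in\mathbb{R}$ and $u\in\mathbb{C}^d$ let $\Phi_{\tau,u}$ be the formal series $$\Phi_{\tau,u}(x)=\varphi_u\big(W_{\gamma(\tau,u)}(x)\big).$$ Then all coefficient maps of $\Phi_{\tau,u}$ are smooth (so that the formal compositions make sense), and for all $\tau,\tau'\in\mathbb{R}$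 and $u,u'\in\mathbb{C}^d$, $$\Phi_{\tau,u}\circ\Phi_{\tau',u'}=\Phi_{\tau+\tau',\,u+u'}$$ as formal series. -/

import Mathlib

open scoped ContDiff

namespace WordSeries

noncomputable section

/-! ### Words, word basis functions, word series -/

section Formal

variable {A : Type*} {E : Type*} [NormedAddCommGroup E] [NormedSpace ℂ E]

/-- Words over the alphabet `A` are lists of letters.  The word basis functions of the maps `f ℓ`
are given by `f_∅ = id` and `f_{ℓ₁ℓ₂⋯ℓₙ}(y) = f'_{ℓ₂⋯ℓₙ}(y) f_{ℓ₁}(y)` for `n > 1`. -/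
def wordBasis (f : A → E → E) : List A → E → E
  | [] => id
  | [ℓ] => f ℓ
  | ℓ₁ :: ℓ₂ :: w => fun y => fderiv ℂ (wordBasis f (ℓ₂ :: w)) y (f ℓ₁ y)

/-- Formal series of maps `E → E`.  A bookkeeping indeterminate `ε_ℓ` is attached to each letter
`ℓ` (i.e. `f ℓ` is replaced by `ε_ℓ f ℓ`, the `ε_ℓ` commuting with each other), and the formal series
`∑_m ε^m F_m(x)` is given by its coefficient maps `F m : E → E`, where `m : A →₀ ℕ` runs over the
multidegrees. -/
abbrev FormalMap (A E : Type*) := (A →₀ ℕ) → E → E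

open Classical in
/-- The finite set of the words that contain each letter `ℓ` exactly `m ℓ` times. -/
def wordsOfContent (m : A →₀ ℕ) : Finset (List A) :=
  (Finsupp.toMultiset m).lists.toFinset

open Classical in
theorem mem_wordsOfContent (m : A →₀ ℕ) (w : List A) :
    w ∈ wordsOfContent m ↔ ∀ ℓ, w.count ℓ = m ℓ := by
  rw [wordsOfContent, Multiset.mem_toFinset, Multiset.mem_lists_iff]
  change Finsupp.toMultiset m = (w : Multiset A) ↔ _
  rw [Multiset.ext]
  refine forall_congr' fun ℓ => ?_
  rw [Finsupp.count_toMultiset, Multiset.coe_count]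
  exact eq_comm

/-- The word series `W_δ(x) = ∑_w δ_w f_w(x)`; the word `w` contributes to the multidegree that
records how often each letter occurs in `w`. -/
def wordSeries (f : A → E → E) (δ : List A → ℂ) : FormalMap A E :=
  fun m x => ∑ w ∈ wordsOfContent m, δ w • wordBasis f w x

open Classical in
/-- An ordinary map, seen as a formal series without terms of positive degree. -/
def ofMap (h : E → E) : FormalMap A E :=
  fun m x => if m = 0 then h x else 0

open Classical in
/-- Composition `F ∘ G` of formal series of smooth maps: in `∑_n ε^n F_n(G_0(x) + η)`, where
`η = ∑_{q ≠ 0} ε^q G_q(x)`, each `F_n` is replaced by its Taylor expansion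
`∑_k (1/k!) D^k F_n(G_0(x))[η, …, η]` and the coefficient of `ε^m` is collected.  A product of `k`
increments has degree at least `k`, so only `k ≤ |p|` can contribute to the multidegree `p`. -/
def FormalMap.comp (F G : FormalMap A E) : FormalMap A E :=
  fun m x =>
    ∑ np ∈ Finset.HasAntidiagonal.antidiagonal m,
      ∑ k ∈ Finset.range (np.2.degree + 1),
        ((Nat.factorial k : ℂ))⁻¹ •
          ∑ q ∈ (Finset.piAntidiag (Finset.univ : Finset (Fin k)) np.2).filter
              (fun q => ∀ i, q i ≠ 0),
            iteratedFDeriv ℂ k (F np.1) (G 0 x) (fun i => G (q i) x)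

end Formal

/-! ### The vector fields `g^u` and their time-one flow maps `φ_u` -/

section Flow

variable {E : Type*} [NormedAddCommGroup E] [NormedSpace ℂ E]

/-- The vector field `g^u = ∑_j u_j g_j`. -/
def linComb {d : ℕ} (g : Fin d → E → E) (u : Fin d → ℂ) : E → E :=
  fun x => ∑ j, u j • g j x

/-- Every initial value problem `c' = X(c)`, `c(0) = x` has a solution on the whole real line. -/
def IsCompleteField (X : E → E) : Prop :=
  ∀ x : E, ∃ c : ℝ → E, c 0 = x ∧ IsIntegralCurve c (fun _ => X)

open Classical in
/-- The flow at time `1` of the vector field `X`: the value at `t = 1` of the solution of `c' = X(c)`,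
`c(0) = x`.  For smooth complete `X` the solution exists and is unique, so that neither the choice
nor the default value matters. -/
def timeOneMap (X : E → E) (x : E) : E :=
  if h : ∃ c : ℝ → E, c 0 = x ∧ IsIntegralCurve c (fun _ => X) then h.choose 1 else x

end Flow

/-! ### The coefficients `γ_w(τ, u)` -/

section Coefficients

variable {A : Type*} [AddCommMonoid A] {d : ℕ}

/-- `ν_ℓ^u = u_1 ν_{1,ℓ} + ⋯ + u_d ν_{d,ℓ}`. -/
def eigenvalue (ν : Fin d → A → ℂ) (u : Fin d → ℂ) (ℓ : A) : ℂ :=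
  ∑ j, u j * ν j ℓ

open Classical in
/-- `gammaAux ν v τ u r w` is the coefficient `γ_{0^r w}(τ, u)` of the word that consists of `r`
letters `0` followed by the word `w`; see `gamma` and the recursions below it. -/
def gammaAux (ν : Fin d → A → ℂ) (v : Fin d → ℂ) (τ : ℝ) (u : Fin d → ℂ) : ℕ → List A → ℂ
  | r, [] => (τ : ℂ) ^ r / (Nat.factorial r : ℂ)
  | 0, [ℓ₀] =>
      if ℓ₀ = 0 then gammaAux ν v τ u 1 []
      else (Complex.exp (eigenvalue ν u ℓ₀) - 1) / eigenvalue ν v ℓ₀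
  | r + 1, [ℓ₀] =>
      if ℓ₀ = 0 then gammaAux ν v τ u (r + 2) []
      else (gammaAux ν v τ u (r + 1) [] * Complex.exp (eigenvalue ν u ℓ₀)
            - gammaAux ν v τ u r [ℓ₀]) / eigenvalue ν v ℓ₀
  | 0, ℓ₀ :: ℓ₁ :: w =>
      if ℓ₀ = 0 then gammaAux ν v τ u 1 (ℓ₁ :: w)
      else (gammaAux ν v τ u 0 ((ℓ₀ + ℓ₁) :: w)
            - gammaAux ν v τ u 0 (ℓ₁ :: w)) / eigenvalue ν v ℓ₀
  | r + 1, ℓ₀ :: ℓ₁ :: w =>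
      if ℓ₀ = 0 then gammaAux ν v τ u (r + 2) (ℓ₁ :: w)
      else (gammaAux ν v τ u (r + 1) ((ℓ₀ + ℓ₁) :: w)
            - gammaAux ν v τ u r (ℓ₀ :: ℓ₁ :: w)) / eigenvalue ν v ℓ₀
termination_by r w => (r + w.length, w.length)
decreasing_by
  all_goals simp_wf
  all_goals first
    | (apply Prod.Lex.left; simp; done)
    | (simp only [Prod.lex_def]; simp; done)
    | (simp only [Prod.lex_def]; simp; omega)

/-- The coefficients `γ_w(τ, u)`. -/
def gamma (ν : Fin d → A → ℂ) (v : Fin d → ℂ) (τ : ℝ) (u : Fin d → ℂ) (w : List A) : ℂ :=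
  gammaAux ν v τ u 0 w

variable (ν : Fin d → A → ℂ) (v : Fin d → ℂ) (τ : ℝ) (u : Fin d → ℂ)

theorem gammaAux_zero_cons (r : ℕ) (w : List A) :
    gammaAux ν v τ u r (0 :: w) = gammaAux ν v τ u (r + 1) w := by
  cases r <;> cases w <;> simp [gammaAux]

theorem gammaAux_replicate_append (r s : ℕ) (w : List A) :
    gammaAux ν v τ u s (List.replicate r 0 ++ w) = gammaAux ν v τ u (s + r) w := by
  induction r generalizing s with
  | zero => simp
  | succ r ih =>
    rw [List.replicate_succ, List.cons_append, gammaAux_zero_cons, ih]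
    congr 1
    omega

theorem gamma_replicate_append (r : ℕ) (w : List A) :
    gamma ν v τ u (List.replicate r 0 ++ w) = gammaAux ν v τ u r w := by
  rw [gamma, gammaAux_replicate_append, Nat.zero_add]

theorem gamma_nil : gamma ν v τ u [] = 1 := by
  simp [gamma, gammaAux]

theorem gamma_singleton {ℓ₀ : A} (h : ℓ₀ ≠ 0) :
    gamma ν v τ u [ℓ₀] = 1 / eigenvalue ν v ℓ₀ * (Complex.exp (eigenvalue ν u ℓ₀) - 1) := by
  rw [gamma, gammaAux, if_neg h, one_div, inv_mul_eq_div]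

theorem gamma_zeros (r : ℕ) :
    gamma ν v τ u (List.replicate r 0) = (τ : ℂ) ^ r / (Nat.factorial r : ℂ) := by
  have h := gamma_replicate_append ν v τ u r []
  rw [List.append_nil] at h
  rw [h, gammaAux]

theorem gamma_zeros_singleton (r : ℕ) {ℓ₀ : A} (h : ℓ₀ ≠ 0) :
    gamma ν v τ u (List.replicate (r + 1) 0 ++ [ℓ₀]) =
      (gamma ν v τ u (List.replicate (r + 1) 0) * Complex.exp (eigenvalue ν u ℓ₀)
        - gamma ν v τ u (List.replicate r 0 ++ [ℓ₀])) / eigenvalue ν v ℓ₀ := by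
  rw [gamma_replicate_append, gamma_replicate_append, gamma_zeros, gammaAux, if_neg h, gammaAux]

theorem gamma_cons_cons {ℓ₀ : A} (h : ℓ₀ ≠ 0) (ℓ₁ : A) (w : List A) :
    gamma ν v τ u (ℓ₀ :: ℓ₁ :: w) =
      (gamma ν v τ u ((ℓ₀ + ℓ₁) :: w) - gamma ν v τ u (ℓ₁ :: w)) / eigenvalue ν v ℓ₀ := by
  rw [gamma, gammaAux, if_neg h, gamma, gamma]

theorem gamma_zeros_cons_cons (r : ℕ) {ℓ₀ : A} (h : ℓ₀ ≠ 0) (ℓ₁ : A) (w : List A) :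
    gamma ν v τ u (List.replicate (r + 1) 0 ++ ℓ₀ :: ℓ₁ :: w) =
      (gamma ν v τ u (List.replicate (r + 1) 0 ++ (ℓ₀ + ℓ₁) :: w)
        - gamma ν v τ u (List.replicate r 0 ++ ℓ₀ :: ℓ₁ :: w)) / eigenvalue ν v ℓ₀ := by
  rw [gamma_replicate_append, gamma_replicate_append, gamma_replicate_append, gammaAux, if_neg h]

end Coefficients

/-! ### The formal maps `Φ_{τ,u}` -/

/-- `Φ_{τ,u}(x) = φ_u(W_{γ(τ,u)}(x))`, where `φ_u` is the flow of `g^u` at time `1`. -/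
def Phi {A : Type*} [AddCommMonoid A] {E : Type*} [NormedAddCommGroup E] [NormedSpace ℂ E] {d : ℕ}
    (g : Fin d → E → E) (f : A → E → E) (ν : Fin d → A → ℂ) (v : Fin d → ℂ)
    (τ : ℝ) (u : Fin d → ℂ) : FormalMap A E :=
  FormalMap.comp (ofMap (timeOneMap (linComb g u))) (wordSeries f (gamma ν v τ u))

end

end WordSeries

/-! For a word `w` let L_w be the iterated Lie derivative `lieWord`, so that f_w = L_w id.
Everything is written as a series Σ γ_w L_w h, and two properties of the coefficients γ carry the
proof.

Multiplicativity (`lieSeries_gamma_mul`): h ↦ Σ γ_w L_w h respects products of scalar functions.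
Hence it respects polynomials and, degree by degree, Taylor expansions: inserting Σ γ_w L_w φ into a
smooth χ yields Σ γ_w L_w(χ ∘ φ) (`taylor_substitution`). In particular Φ_{τ,u} = Σ γ_w(τ,u) L_w φ_u
(`Phi_eq_lieCoeff`).

Convolution (`gamma_add`): γ_w(τ+τ',u+u') is the sum of γ_{w'}(τ',u') exp(ν^{u'}_{w''}) γ_{w''}(τ,u)
over all splittings w = w'w'', where ν^{u'} is summed over letters.

Both properties are proved for lifts of γ to exponential polynomials in τ and symbols E^ℓ, with the
derivation ∂τ = 1, ∂E^ℓ = ν^v_ℓ E^ℓ. The recursion for γ amounts to ∂γ_{wℓ} = E^ℓ γ_w, with γ_w = 0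
at the origin for w ≠ ∅. By non-resonance ∂ kills only constants, so an identity may be checked by
differentiating it and comparing values at the origin.

Substitution turns the composition into a sum of γ_{w'}(τ',u') γ_{w''}(τ,u) L_{w'}((L_{w''} φ_u) ∘
φ_{u'}). The relations [g_j, f_ℓ] = ν_{j,ℓ} f_ℓ move φ_{u'} inside L_{w''} at the cost of
exp(ν^{u'}_{w''}) (`lieWord_comp_eq`), commutation of the g_j gives φ_u ∘ φ_{u'} = φ_{u+u'}
(`timeOneMap_linComb_add`), and convolution collects the result. Smoothness of φ_u comes from the
variational equation and iterated tangent lifts (`contDiff_timeOneMap`). -/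

namespace WordSeries

/-! ### Integral curves: stability and uniqueness on [0, 1] -/

section FlowBounds

open Set Metric
open scoped NNReal Topology

variable {E : Type*} [NormedAddCommGroup E] [NormedSpace ℂ E] [FiniteDimensional ℂ E]
  {F : Type*} [NormedAddCommGroup F] [NormedSpace ℂ F]

theorem exists_lipschitzOnWith_closedBall {X : E → F} (hX : ContDiff ℂ 1 X) (R : ℝ) :
    ∃ K : ℝ≥0, LipschitzOnWith K X (closedBall 0 R) := by
  have : ProperSpace E := FiniteDimensional.proper ℂ E
  obtain ⟨C, hC⟩ := (isCompact_closedBall (0 : E) R).exists_bound_of_continuousOn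
    (hX.continuous_fderiv one_ne_zero).continuousOn
  refine ⟨C.toNNReal, Convex.lipschitzOnWith_of_nnnorm_fderiv_le (𝕜 := ℂ)
    (fun x _ => hX.differentiable one_ne_zero x) (fun x hx => ?_) (convex_closedBall _ _)⟩
  rw [← NNReal.coe_le_coe, coe_nnnorm]
  exact (hC x hx).trans (Real.le_coe_toNNReal C)

/-- Integral curves that start close to a given one stay close to it on `[0, 1]`. -/
theorem exists_tube {X : E → E} (hX : ContDiff ℂ 1 X) {c : ℝ → E}
    (hc : IsIntegralCurve c (fun _ => X)) :
    ∃ (R : ℝ) (K : ℝ≥0) (δ : ℝ), 0 < δ ∧ LipschitzOnWith K X (closedBall 0 R) ∧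
      (∀ t ∈ Icc (0 : ℝ) 1, c t ∈ closedBall 0 R) ∧
      ∀ y : ℝ → E, IsIntegralCurve y (fun _ => X) → dist (y 0) (c 0) < δ →
        ∀ t ∈ Icc (0 : ℝ) 1, y t ∈ closedBall 0 R ∧
          dist (y t) (c t) ≤ dist (y 0) (c 0) * Real.exp K := by
  obtain ⟨R, hR⟩ := (isCompact_Icc (a := (0 : ℝ)) (b := 1)).exists_bound_of_continuousOn
    hc.continuous.continuousOn
  obtain ⟨K, hK⟩ := exists_lipschitzOnWith_closedBall hX (R + 1)
  have hball : ∀ t ∈ Icc (0 : ℝ) 1, ∀ z : E, dist z (c t) ≤ 1 → z ∈ closedBall (0 : E) (R + 1) := by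
    intro t ht z hz
    rw [mem_closedBall_zero_iff]
    have := hR t ht
    rw [dist_eq_norm] at hz
    have := norm_add_le (z - c t) (c t)
    rw [sub_add_cancel] at this
    linarith
  -- `K` is a Lipschitz constant on the ball containing the unit tube around `c`. Starting within
  -- exp(-K), a curve can be driven apart at most to distance 1, so it never leaves the tube where
  -- `K` is valid.
  refine ⟨R + 1, K, Real.exp (-K), Real.exp_pos _, hK,
    fun t ht => hball t ht _ (by simp), fun y hy hyc => ?_⟩
  set S : Set ℝ := {t | dist (y t) (c t) ≤ dist (y 0) (c 0) * Real.exp (K * t)} with hS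
  have hexp : ∀ t ∈ Icc (0 : ℝ) 1, Real.exp (K * t) ≤ Real.exp K := fun t ht =>
    Real.exp_le_exp.mpr (mul_le_of_le_one_right K.2 ht.2)
  have hlt : dist (y 0) (c 0) * Real.exp K < 1 := by
    have := mul_lt_mul_of_pos_right hyc (Real.exp_pos K)
    rwa [← Real.exp_add, neg_add_cancel, Real.exp_zero] at this
  have hle : ∀ t ∈ S ∩ Icc 0 1, dist (y t) (c t) ≤ dist (y 0) (c 0) * Real.exp K := fun t ht =>
    ht.1.trans (mul_le_mul_of_nonneg_left (hexp t ht.2) dist_nonneg)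
  -- Continuous induction: at a point of `S` the distance is strictly below 1, so both curves remain
  -- in the ball a little longer, and Grönwall restarted there extends the estimate.
  have hsub : Icc (0 : ℝ) 1 ⊆ S := by
    refine IsClosed.Icc_subset_of_forall_exists_gt ?_ ?_ ?_
    · refine IsClosed.inter (isClosed_le ?_ ?_) isClosed_Icc
      · exact hy.continuous.dist hc.continuous
      · fun_prop
    · simp [hS]
    · rintro t ⟨htS, ht⟩ z (hz : t < z)
      have h1 : dist (y t) (c t) < 1 := (hle t ⟨htS, Ico_subset_Icc_self ht⟩).trans_lt hlt
      have hev : ∀ᶠ s in 𝓝 t, dist (y s) (c s) < 1 :=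
        (hy.continuous.dist hc.continuous).continuousAt.eventually_lt_const h1
      obtain ⟨η, hη, hηs⟩ := Metric.eventually_nhds_iff.mp hev
      have hm : 0 < min (min (η / 2) (z - t)) (1 - t) :=
        lt_min (lt_min (half_pos hη) (sub_pos.mpr hz)) (sub_pos.mpr ht.2)
      set e := min (min (η / 2) (z - t)) (1 - t)
      have he1 : e ≤ η / 2 := (min_le_left _ _).trans (min_le_left _ _)
      have he2 : e ≤ z - t := (min_le_left _ _).trans (min_le_right _ _)
      have he3 : e ≤ 1 - t := min_le_right _ _
      refine ⟨t + e, ?_, by linarith, by linarith⟩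
      have hnear : ∀ s ∈ Ico t (t + e), dist (y s) (c s) ≤ 1 := fun s hs =>
        (hηs (by rw [Real.dist_eq, abs_of_nonneg (sub_nonneg.mpr hs.1)]; linarith [hs.2])).le
      have hIcc : ∀ s ∈ Ico t (t + e), s ∈ Icc (0 : ℝ) 1 := fun s hs =>
        ⟨ht.1.trans hs.1, by linarith [hs.2]⟩
      have := dist_le_of_trajectories_ODE_of_mem (v := fun _ => X)
        (s := fun _ => closedBall (0 : E) (R + 1)) (K := K)
        (a := t) (b := t + e) (f := y) (g := c) (fun _ _ => hK)
        hy.continuous.continuousOn (fun s _ => (hy s).hasDerivWithinAt)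
        (fun s hs => hball s (hIcc s hs) _ (hnear s hs))
        hc.continuous.continuousOn (fun s _ => (hc s).hasDerivWithinAt)
        (fun s hs => hball s (hIcc s hs) _ (by simp)) htS (t + e) ⟨by linarith, le_rfl⟩
      rw [mul_assoc, ← Real.exp_add] at this
      refine this.trans_eq ?_
      congr 2
      ring
  intro t ht
  exact ⟨hball t ht _ ((hle t ⟨hsub ht, ht⟩).trans hlt.le), hle t ⟨hsub ht, ht⟩⟩

/-- Uniqueness: the chosen curve starts at distance 0 from `c`, and the tube estimate keeps it
there. -/
theorem timeOneMap_eq {X : E → E} (hX : ContDiff ℂ 1 X) {c : ℝ → E}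
    (hc : IsIntegralCurve c (fun _ => X)) : timeOneMap X (c 0) = c 1 := by
  have h : ∃ b : ℝ → E, b 0 = c 0 ∧ IsIntegralCurve b (fun _ => X) := ⟨c, rfl, hc⟩
  rw [timeOneMap, dif_pos h]
  obtain ⟨h0, hb⟩ := h.choose_spec
  obtain ⟨R, K, δ, hδ, -, -, H⟩ := exists_tube hX hc
  have := (H _ hb (by rwa [h0, dist_self]) 1 ⟨zero_le_one, le_rfl⟩).2
  rw [h0, dist_self, zero_mul] at this
  exact dist_le_zero.mp this

end FlowBounds

/-! ### Linear differential equations via Dyson series -/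

section LinearODE

open Set
open scoped NNReal Topology Nat

variable {B : Type*} [NormedRing B] [NormedAlgebra ℝ B]

/-- The terms of the Dyson series of `M' = a(t) M`, `M(0) = 1`. -/
noncomputable def dysonTerm (a : ℝ → B) : ℕ → ℝ → B
  | 0 => fun _ => 1
  | k + 1 => fun t => ∫ s in (0 : ℝ)..t, a s * dysonTerm a k s

theorem continuous_dysonTerm {a : ℝ → B} (ha : Continuous a) (k : ℕ) :
    Continuous (dysonTerm a k) := by
  induction k with
  | zero => exact continuous_const
  | succ k ih =>
    exact intervalIntegral.continuous_primitive
      (fun _ _ => (ha.mul ih).intervalIntegrable _ _) 0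

theorem hasDerivAt_dysonTerm [CompleteSpace B] {a : ℝ → B} (ha : Continuous a) (k : ℕ) (t : ℝ) :
    HasDerivAt (dysonTerm a (k + 1)) (a t * dysonTerm a k t) t :=
  intervalIntegral.integral_hasDerivAt_right
    ((ha.mul (continuous_dysonTerm ha k)).intervalIntegrable _ _)
    ((ha.mul (continuous_dysonTerm ha k)).stronglyMeasurableAtFilter _ _)
    (ha.mul (continuous_dysonTerm ha k)).continuousAt

/-- Each integration of |s|^k / k! raises the exponent and the factorial. The resulting exponential
majorant allows the Dyson series to be differentiated termwise. -/
theorem norm_dysonTerm_le {a : ℝ → B} {K T : ℝ} (hK : 0 ≤ K)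
    (haK : ∀ t, |t| ≤ T → ‖a t‖ ≤ K) (k : ℕ) {t : ℝ} (ht : |t| ≤ T) :
    ‖dysonTerm a k t‖ ≤ ‖(1 : B)‖ * ((K * |t|) ^ k / k !) := by
  induction k generalizing t with
  | zero => simp [dysonTerm]
  | succ k ih =>
    have hs : ∀ s ∈ uIoc 0 t, ‖a s * dysonTerm a k s‖ ≤
        K * (‖(1 : B)‖ * (K ^ k / k !)) * |s - 0| ^ k := by
      intro s hs
      have hst : |s| ≤ |t| := by
        rcases le_total 0 t with h | h
        · rw [uIoc_of_le h] at hs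
          rw [abs_of_pos hs.1, abs_of_nonneg h]; exact hs.2
        · rw [uIoc_of_ge h] at hs
          rw [abs_of_nonpos hs.2, abs_of_nonpos h]; linarith [hs.1]
      calc ‖a s * dysonTerm a k s‖ ≤ ‖a s‖ * ‖dysonTerm a k s‖ := norm_mul_le _ _
        _ ≤ K * (‖(1 : B)‖ * ((K * |s|) ^ k / k !)) :=
          mul_le_mul (haK s (hst.trans ht)) (ih (hst.trans ht)) (norm_nonneg _) hK
        _ = _ := by rw [sub_zero, mul_pow]; ring
    calc ‖dysonTerm a (k + 1) t‖ ≤ ∫ s in uIoc 0 t, ‖a s * dysonTerm a k s‖ :=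
          intervalIntegral.norm_integral_le_integral_norm_uIoc
      _ ≤ ∫ s in uIoc 0 t, K * (‖(1 : B)‖ * (K ^ k / k !)) * |s - 0| ^ k := by
          refine MeasureTheory.integral_mono_of_nonneg
            (Filter.Eventually.of_forall fun _ => norm_nonneg _) ?_ ?_
          · exact (Continuous.integrableOn_uIoc (by fun_prop))
          · exact (MeasureTheory.ae_restrict_mem measurableSet_uIoc).mono hs
      _ = _ := by
          rw [MeasureTheory.integral_const_mul, integral_pow_abs_sub_uIoc, sub_zero,
            Nat.factorial_succ, mul_pow, pow_succ K]
          push_cast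
          field_simp

/-- The linear equation `M' = a(t) M`, `M(0) = 1` in a Banach algebra has a global solution. -/
theorem exists_hasDerivAt_mul [CompleteSpace B] {a : ℝ → B} (ha : Continuous a) :
    ∃ M : ℝ → B, M 0 = 1 ∧ ∀ t, HasDerivAt M (a t * M t) t := by
  refine ⟨fun t => ∑' k, dysonTerm a k t, ?_, fun t => ?_⟩
  · beta_reduce
    rw [tsum_eq_single 0]
    · rfl
    · rintro (_ | k) hk
      · exact absurd rfl hk
      · simp [dysonTerm]
  · set T : ℝ := |t| + 1
    have hT : 0 ≤ T := by positivity
    obtain ⟨C, hC⟩ := (isCompact_Icc (a := -T) (b := T)).exists_bound_of_continuousOn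
      ha.continuousOn
    have hK : 0 ≤ max C 0 := le_max_right _ _
    have haK : ∀ s, |s| ≤ T → ‖a s‖ ≤ max C 0 := fun s hs =>
      (hC s (abs_le.mp hs)).trans (le_max_left _ _)
    set K := max C 0
    have hsum : Summable fun k : ℕ => ‖(1 : B)‖ * ((K * T) ^ k / k !) :=
      (Real.summable_pow_div_factorial _).mul_left _
    have hle : ∀ k s, |s| ≤ T → ‖dysonTerm a k s‖ ≤ ‖(1 : B)‖ * ((K * T) ^ k / k !) :=
      fun k s hs => (norm_dysonTerm_le hK haK k hs).trans (by gcongr)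
    -- The constant term of the series has derivative 0; every later term differentiates to `a`
    -- times its predecessor, hence the index shift here and in the majorant `u`.
    let g' : ℕ → ℝ → B := fun k s => Nat.casesOn k 0 fun j => a s * dysonTerm a j s
    let u : ℕ → ℝ := fun k => Nat.casesOn k 0 fun j => K * (‖(1 : B)‖ * ((K * T) ^ j / j !))
    have hu : Summable u := (summable_nat_add_iff 1).mp (hsum.mul_left K)
    have hsumt : Summable fun k => dysonTerm a k t :=
      .of_norm_bounded hsum fun k => hle k t (by simp [T])
    have hmem : t ∈ Ioo (-T) T := by
      rw [mem_Ioo, ← abs_lt]; simp [T]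
    have := hasDerivAt_tsum_of_isPreconnected (g := dysonTerm a) (g' := g') hu isOpen_Ioo
      isPreconnected_Ioo (t := Ioo (-T) T) (y₀ := t) (y := t) ?_ ?_ hmem hsumt hmem
    · have hg't : Summable fun k => g' k t :=
        (summable_nat_add_iff 1).mp (hsumt.mul_left (a t))
      rw [hg't.tsum_eq_zero_add] at this
      simpa [g', tsum_mul_left, hsumt.tsum_mul_left] using this
    · rintro (_ | k) s -
      · exact hasDerivAt_const s (1 : B)
      · exact hasDerivAt_dysonTerm ha k s
    · rintro (_ | k) s hs
      · simp [g', u]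
      · have hs' : |s| ≤ T := (abs_lt.mpr hs).le
        exact (norm_mul_le _ _).trans (mul_le_mul (haK s hs') (hle k s hs') (norm_nonneg _) hK)

end LinearODE

/-! ### Smoothness of the time-one map and transport of eigenfields -/

section FlowDeriv

open Set Metric
open scoped NNReal Topology

variable {E : Type*} [NormedAddCommGroup E] [NormedSpace ℂ E]

theorem contDiff_fderiv_apply {F : Type*} [NormedAddCommGroup F] [NormedSpace ℂ F]
    {h : E → F} {X : E → E} (hh : ContDiff ℂ ∞ h) (hX : ContDiff ℂ ∞ X) :
    ContDiff ℂ ∞ fun y => fderiv ℂ h y (X y) :=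
  (hh.fderiv_right (m := ∞) (by simp)).clm_apply hX

/-- The variational equation: the derivative of the time-one map. -/
theorem exists_hasFDerivAt_timeOneMap [FiniteDimensional ℂ E] {X : E → E}
    (hX : ContDiff ℂ ∞ X) (hcpl : IsCompleteField X)
    {c : ℝ → E} (hc : IsIntegralCurve c (fun _ => X)) :
    ∃ M : ℝ → E →L[ℂ] E, M 0 = 1 ∧ (∀ t, HasDerivAt M (fderiv ℂ X (c t) * M t) t) ∧
      HasFDerivAt (timeOneMap X) (M 1) (c 0) := by
  have hcE : CompleteSpace E := FiniteDimensional.complete ℂ E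
  have hX1 : ContDiff ℂ 1 X := hX.of_le (by simp)
  have hdX : ContDiff ℂ 1 (fderiv ℂ X) :=
    (hX.fderiv_right (m := ∞) (by simp)).of_le (by simp)
  obtain ⟨M, hM0, hM⟩ := exists_hasDerivAt_mul (a := fun t => fderiv ℂ X (c t))
    (hdX.continuous.comp hc.continuous)
  refine ⟨M, hM0, hM, ?_⟩
  obtain ⟨R, K, δ, hδ, -, hcR, htube⟩ := exists_tube hX1 hc
  obtain ⟨L, hL⟩ := exists_lipschitzOnWith_closedBall hdX R
  obtain ⟨N, hN⟩ := (isCompact_Icc (a := (0 : ℝ)) (b := 1)).exists_bound_of_continuousOn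
    (hdX.continuous.comp hc.continuous).continuousOn
  set C : ℝ := gronwallBound 0 N (L * Real.exp K ^ 2) 1
  have key : ∀ x ∈ ball (c 0) δ,
      ‖timeOneMap X x - timeOneMap X (c 0) - M 1 (x - c 0)‖ ≤
        gronwallBound 0 N (L * Real.exp K ^ 2 * ‖x - c 0‖ ^ 2) 1 := by
    intro x hx
    obtain ⟨y, rfl, hy⟩ := hcpl x
    have hy' := htube y hy hx
    rw [timeOneMap_eq hX1 hc, timeOneMap_eq hX1 hy]
    -- The linearization error satisfies the variational equation up to the first-order Taylor
    -- remainder of `X` along the curves, which is quadratic in the initial distance; Grönwall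
    -- therefore gives a quadratic bound at time 1.
    have hder : ∀ t, HasDerivAt (fun t => y t - c t - M t (y 0 - c 0))
        (X (y t) - X (c t) - fderiv ℂ X (c t) (M t (y 0 - c 0))) t := fun t =>
      ((hy t).sub (hc t)).sub
        (((ContinuousLinearMap.apply ℂ E (y 0 - c 0)).restrictScalars ℝ).hasFDerivAt.comp_hasDerivAt
          t (hM t))
    have := norm_le_gronwallBound_of_norm_deriv_right_le (δ := 0) (K := N)
      (ε := L * Real.exp K ^ 2 * ‖y 0 - c 0‖ ^ 2) (a := 0) (b := 1)
      (fun t _ => (hder t).continuousAt.continuousWithinAt)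
      (fun t _ => (hder t).hasDerivWithinAt) (by simp [hM0]) (fun t ht => ?_)
      1 ⟨zero_le_one, le_rfl⟩
    · simpa using this
    · have ht' := Ico_subset_Icc_self ht
      have hyt := hy' t ht'
      have hseg : segment ℝ (c t) (y t) ⊆ closedBall 0 R :=
        (convex_closedBall _ _).segment_subset (hcR t ht') hyt.1
      have h1 : ‖X (y t) - X (c t) - fderiv ℂ X (c t) (y t - c t)‖ ≤
          (L * ‖y t - c t‖) * ‖y t - c t‖ := by
        refine Convex.norm_image_sub_le_of_norm_fderiv_le' (𝕜 := ℂ) (s := segment ℝ (c t) (y t))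
          (fun z _ => hX1.differentiable one_ne_zero z) (fun z hz => ?_) (convex_segment _ _)
          (left_mem_segment _ _ _) (right_mem_segment _ _ _)
        refine (hL.norm_sub_le (hseg hz) (hcR t ht')).trans ?_
        exact mul_le_mul_of_nonneg_left (norm_sub_le_of_mem_segment hz) L.2
      have h2 : ‖y t - c t‖ ≤ ‖y 0 - c 0‖ * Real.exp K := by simpa [dist_eq_norm] using hyt.2
      have h3 : (L * ‖y t - c t‖) * ‖y t - c t‖ ≤ L * Real.exp K ^ 2 * ‖y 0 - c 0‖ ^ 2 := by
        calc (L * ‖y t - c t‖) * ‖y t - c t‖ = L * ‖y t - c t‖ ^ 2 := by ring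
          _ ≤ L * (‖y 0 - c 0‖ * Real.exp K) ^ 2 := by gcongr
          _ = _ := by ring
      have h4 : ‖fderiv ℂ X (c t) (y t - c t - M t (y 0 - c 0))‖ ≤
          N * ‖y t - c t - M t (y 0 - c 0)‖ :=
        ContinuousLinearMap.le_of_opNorm_le _ (hN t ht') _
      calc ‖X (y t) - X (c t) - fderiv ℂ X (c t) (M t (y 0 - c 0))‖
          = ‖fderiv ℂ X (c t) (y t - c t - M t (y 0 - c 0)) +
              (X (y t) - X (c t) - fderiv ℂ X (c t) (y t - c t))‖ := by
            congr 1
            rw [map_sub (fderiv ℂ X (c t)) (y t - c t)]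
            abel
        _ ≤ _ := (norm_add_le _ _).trans (add_le_add h4 (h1.trans h3))
  -- With zero initial error the Grönwall bound is linear in the forcing, so `C` does not depend on
  -- the starting point.
  have hlin : ∀ e : ℝ, gronwallBound 0 N (L * Real.exp K ^ 2 * e) 1 = C * e := by
    intro e
    by_cases h : N = 0
    · simp [C, gronwallBound, h]
    · simp only [C, gronwallBound_of_K_ne_0 h]
      ring
  rw [hasFDerivAt_iff_isLittleO]
  refine Asymptotics.IsBigO.trans_isLittleO (g := fun x => ‖x - c 0‖ ^ 2) ?_ ?_
  · refine Asymptotics.IsBigO.of_bound C ?_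
    filter_upwards [ball_mem_nhds (c 0) hδ] with x hx
    rw [Real.norm_of_nonneg (by positivity), ← hlin]
    exact key x hx
  · exact Asymptotics.isLittleO_norm_pow_id one_lt_two |>.comp_tendsto
      (tendsto_sub_nhds_zero_iff.mpr Filter.tendsto_id)

/-- The tangent lift of a vector field. -/
noncomputable def tangentField (X : E → E) : E × E → E × E :=
  fun p => (X p.1, fderiv ℂ X p.1 p.2)

theorem contDiff_tangentField {X : E → E} (hX : ContDiff ℂ ∞ X) :
    ContDiff ℂ ∞ (tangentField X) :=
  (hX.comp contDiff_fst).prodMk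
    (((hX.fderiv_right (m := ∞) (by simp)).comp contDiff_fst).clm_apply contDiff_snd)

theorem timeOneMap_differentiable [FiniteDimensional ℂ E] {X : E → E}
    (hX : ContDiff ℂ ∞ X) (hcpl : IsCompleteField X) :
    Differentiable ℂ (timeOneMap X) := by
  intro x
  obtain ⟨c, rfl, hc⟩ := hcpl x
  obtain ⟨M, -, -, h⟩ := exists_hasFDerivAt_timeOneMap hX hcpl hc
  exact h.differentiableAt

/-- An integral curve paired with the variational solution applied to a vector solves the lifted
equation. So the flow of the lift is the tangent map of the flow, and the lift is again complete. -/
theorem tangentField_curve [FiniteDimensional ℂ E] {X : E → E}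
    (hX : ContDiff ℂ ∞ X) (hcpl : IsCompleteField X)
    (p : E × E) : ∃ b : ℝ → E × E, b 0 = p ∧ IsIntegralCurve b (fun _ => tangentField X) ∧
      b 1 = (timeOneMap X p.1, fderiv ℂ (timeOneMap X) p.1 p.2) := by
  obtain ⟨x, ξ⟩ := p
  obtain ⟨c, rfl, hc⟩ := hcpl x
  obtain ⟨M, hM0, hM, h⟩ := exists_hasFDerivAt_timeOneMap hX hcpl hc
  refine ⟨fun t => (c t, M t ξ), by simp [hM0], fun t => ?_, ?_⟩
  · exact (hc t).prodMk
      (((ContinuousLinearMap.apply ℂ E ξ).restrictScalars ℝ).hasFDerivAt.comp_hasDerivAt t (hM t))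
  · rw [timeOneMap_eq (hX.of_le (by simp)) hc, h.fderiv]

theorem isCompleteField_tangentField [FiniteDimensional ℂ E] {X : E → E} (hX : ContDiff ℂ ∞ X)
    (hcpl : IsCompleteField X) : IsCompleteField (tangentField X) := fun p =>
  let ⟨b, h0, hb, _⟩ := tangentField_curve hX hcpl p
  ⟨b, h0, hb⟩

theorem timeOneMap_tangentField [FiniteDimensional ℂ E] {X : E → E} (hX : ContDiff ℂ ∞ X)
    (hcpl : IsCompleteField X) (p : E × E) :
    timeOneMap (tangentField X) p = (timeOneMap X p.1, fderiv ℂ (timeOneMap X) p.1 p.2) := by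
  obtain ⟨b, rfl, hb, h1⟩ := tangentField_curve hX hcpl p
  rw [timeOneMap_eq ((contDiff_tangentField hX).of_le (by simp)) hb, h1]

/-- The derivative of the time-one map is a component of the time-one map of the tangent lift, to
which the induction hypothesis applies. The space must vary in the induction, since the lift lives
on `E × E`. -/
theorem contDiff_nat_timeOneMap (n : ℕ) {E : Type*} [NormedAddCommGroup E] [NormedSpace ℂ E]
    [FiniteDimensional ℂ E] {X : E → E} (hX : ContDiff ℂ ∞ X)
    (hcpl : IsCompleteField X) : ContDiff ℂ n (timeOneMap X) := by
  induction n generalizing E with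
  | zero =>
    exact contDiff_zero.mpr (timeOneMap_differentiable hX hcpl).continuous
  | succ n ih =>
    rw [Nat.cast_succ, contDiff_succ_iff_fderiv]
    refine ⟨timeOneMap_differentiable hX hcpl, by simp, contDiff_clm_apply_iff.mpr fun ξ => ?_⟩
    have h := ih (contDiff_tangentField hX) (isCompleteField_tangentField hX hcpl)
    have := (h.comp (contDiff_prodMk_left ξ)).snd
    simpa [Function.comp_def, timeOneMap_tangentField hX hcpl] using this

theorem contDiff_timeOneMap [FiniteDimensional ℂ E] {X : E → E} (hX : ContDiff ℂ ∞ X)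
    (hcpl : IsCompleteField X) : ContDiff ℂ ∞ (timeOneMap X) :=
  contDiff_infty.mpr fun n => contDiff_nat_timeOneMap n hX hcpl

/-- An eigenvector of `ad X` is transported by the flow of `X`. -/
theorem apply_timeOneMap_of_lieBracket_eq [FiniteDimensional ℂ E] {X f : E → E} {μ : ℂ}
    (hX : ContDiff ℂ ∞ X)
    (hcpl : IsCompleteField X) (hf : ContDiff ℂ ∞ f)
    (h : VectorField.lieBracket ℂ X f = μ • f) (x : E) :
    f (timeOneMap X x) = Complex.exp μ • fderiv ℂ (timeOneMap X) x (f x) := by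
  obtain ⟨c, rfl, hc⟩ := hcpl x
  -- The eigenvalue relation says that `f` along `c`, damped by exp(-μt), solves the variational
  -- equation; comparing at time 1 gives the claim.
  have hcurve : IsIntegralCurve (fun t : ℝ => (c t, Complex.exp (-μ * t) • f (c t)))
      (fun _ => tangentField X) := by
    intro t
    refine (hc t).prodMk ?_
    have h1 : HasDerivAt (fun t => f (c t)) (fderiv ℂ f (c t) (X (c t))) t :=
      ((hf.differentiable (by simp) (c t)).hasFDerivAt.restrictScalars ℝ).comp_hasDerivAt t (hc t)
    have h2 : HasDerivAt (fun t : ℝ => Complex.exp (-μ * t)) (Complex.exp (-μ * t) * -μ) t := by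
      have := ((hasDerivAt_id (t : ℂ)).const_mul (-μ)).cexp.comp_ofReal
      simpa using this
    have h3 := congrFun h (c t)
    rw [VectorField.lieBracket, Pi.smul_apply, sub_eq_iff_eq_add] at h3
    refine (h2.smul h1).congr_deriv ?_
    rw [h3, map_smul, smul_add, smul_smul, mul_neg, neg_smul]
    abel
  have h1 := timeOneMap_eq ((contDiff_tangentField hX).of_le (by simp)) hcurve
  simp only [Complex.ofReal_zero, mul_zero, Complex.exp_zero, one_smul, Complex.ofReal_one,
    mul_one] at h1
  rw [timeOneMap_tangentField hX hcpl] at h1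
  rw [timeOneMap_eq (hX.of_le (by simp)) hc,
    show fderiv ℂ (timeOneMap X) (c 0) (f (c 0)) = _ from (Prod.ext_iff.mp h1).2, smul_smul,
    ← Complex.exp_add]
  simp

end FlowDeriv

/-! ### The flows φ_u form a group -/

section CommutingFlows

variable {E : Type*} [NormedAddCommGroup E] [NormedSpace ℂ E] {d : ℕ}
  {g : Fin d → E → E}

theorem contDiff_linComb (hg : ∀ j, ContDiff ℂ ∞ (g j)) (u : Fin d → ℂ) :
    ContDiff ℂ ∞ (linComb g u) :=
  ContDiff.sum fun j _ => (hg j).const_smul (u j)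

theorem lieBracket_linComb_left (hg : ∀ j, ContDiff ℂ ∞ (g j)) {f : E → E} {μ : Fin d → ℂ}
    (h : ∀ j, VectorField.lieBracket ℂ (g j) f = μ j • f) (u : Fin d → ℂ) :
    VectorField.lieBracket ℂ (linComb g u) f = (∑ j, u j * μ j) • f := by
  ext1 x
  have h1 : fderiv ℂ (linComb g u) x = ∑ j, u j • fderiv ℂ (g j) x := by
    unfold linComb
    rw [fderiv_fun_sum (A := fun j x => u j • g j x)
      fun j _ => ((hg j).differentiable (by simp) x).const_smul (u j)]
    exact Finset.sum_congr rfl fun j _ =>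
      fderiv_fun_const_smul ((hg j).differentiable (by simp) x) (u j)
  have h2 : ∀ j, fderiv ℂ f x (g j x) - fderiv ℂ (g j) x (f x) = μ j • f x := fun j =>
    congrFun (h j) x
  rw [VectorField.lieBracket, h1, linComb, map_sum, sum_apply,
    ← Finset.sum_sub_distrib, Pi.smul_apply, Finset.sum_smul]
  refine Finset.sum_congr rfl fun j _ => ?_
  rw [map_smul, smul_apply, ← smul_sub, h2, smul_smul]

theorem lieBracket_linComb_eq_zero (hg : ∀ j, ContDiff ℂ ∞ (g j))
    (hcomm : ∀ j k, VectorField.lieBracket ℂ (g j) (g k) = 0) (u u' : Fin d → ℂ) :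
    VectorField.lieBracket ℂ (linComb g u) (linComb g u') = 0 := by
  have h1 : ∀ k, VectorField.lieBracket ℂ (linComb g u') (g k) = 0 := fun k => by
    simpa using lieBracket_linComb_left hg (f := g k) (μ := 0) (fun j => by simp [hcomm]) u'
  have h2 : ∀ k, VectorField.lieBracket ℂ (g k) (linComb g u') = (0 : ℂ) • linComb g u' :=
    fun k => by
      ext1 x
      rw [VectorField.lieBracket_swap, h1]
      simp
  simpa using lieBracket_linComb_left hg (μ := 0) h2 u

/-- The fields `g^u`, with `u` as an additional constant of motion. -/
noncomputable def paramField (g : Fin d → E → E) : E × (Fin d → ℂ) → E × (Fin d → ℂ) :=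
  fun p => (linComb g p.2 p.1, 0)

theorem contDiff_paramField (hg : ∀ j, ContDiff ℂ ∞ (g j)) : ContDiff ℂ ∞ (paramField g) := by
  refine ContDiff.prodMk (ContDiff.sum fun j _ => ContDiff.smul ?_ ((hg j).comp contDiff_fst))
    contDiff_const
  exact (contDiff_apply ℂ ℂ j).comp contDiff_snd

theorem paramField_curve {u : Fin d → ℂ} {c : ℝ → E}
    (hc : IsIntegralCurve c (fun _ => linComb g u)) :
    IsIntegralCurve (fun t => (c t, u)) (fun _ => paramField g) := fun t =>
  (hc t).prodMk (hasDerivAt_const t u)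

theorem isCompleteField_paramField (hcomplete : ∀ u : Fin d → ℂ, IsCompleteField (linComb g u)) :
    IsCompleteField (paramField g) := by
  rintro ⟨x, u⟩
  obtain ⟨c, rfl, hc⟩ := hcomplete u x
  exact ⟨fun t => (c t, u), rfl, paramField_curve hc⟩

/-- With the parameter as part of the state, differentiability in the initial value yields joint
differentiability of φ_u(x) in x and u. -/
theorem timeOneMap_paramField [FiniteDimensional ℂ E] (hg : ∀ j, ContDiff ℂ ∞ (g j))
    (hcomplete : ∀ u : Fin d → ℂ, IsCompleteField (linComb g u)) (x : E) (u : Fin d → ℂ) :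
    timeOneMap (paramField g) (x, u) = (timeOneMap (linComb g u) x, u) := by
  obtain ⟨c, rfl, hc⟩ := hcomplete u x
  rw [timeOneMap_eq ((contDiff_linComb hg u).of_le (by simp)) hc]
  exact timeOneMap_eq ((contDiff_paramField hg).of_le (by simp)) (paramField_curve hc)

theorem timeOneMap_linComb_smul [FiniteDimensional ℂ E] (hg : ∀ j, ContDiff ℂ ∞ (g j))
    {u : Fin d → ℂ} {c : ℝ → E}
    (hc : IsIntegralCurve c (fun _ => linComb g u)) (s : ℝ) :
    timeOneMap (linComb g (s • u)) (c 0) = c s := by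
  have h := hc.comp_mul s
  have h' : IsIntegralCurve (c ∘ (· * s)) (fun _ => linComb g (s • u)) := by
    intro t
    refine (h t).congr_deriv ?_
    simp [linComb, Finset.smul_sum, mul_smul]
  simpa using timeOneMap_eq ((contDiff_linComb hg _).of_le (by simp)) h'

theorem timeOneMap_linComb_zero [FiniteDimensional ℂ E] (x : E) :
    timeOneMap (linComb g 0) x = x := by
  have h : IsIntegralCurve (fun _ : ℝ => x) (fun _ => linComb g 0) :=
    isIntegralCurve_const fun _ => by simp [linComb]
  have h0 : linComb g 0 = fun _ => 0 := by ext1; simp [linComb]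
  exact timeOneMap_eq (h0 ▸ contDiff_const) h

/-- The curve t ↦ φ_{tu}(φ_{tu'}(x)) is an integral curve of g^{u+u'}. Its velocity splits into a
part through the point, where φ_{tu} carries g^{u'} to itself because the fields commute (eigenvalue
0), and a part through the parameter, which is g^u. -/
theorem timeOneMap_linComb_add [FiniteDimensional ℂ E] (hg : ∀ j, ContDiff ℂ ∞ (g j))
    (hcomm : ∀ j k, VectorField.lieBracket ℂ (g j) (g k) = 0)
    (hcomplete : ∀ u : Fin d → ℂ, IsCompleteField (linComb g u)) (u u' : Fin d → ℂ) (x : E) :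
    timeOneMap (linComb g u) (timeOneMap (linComb g u') x) = timeOneMap (linComb g (u + u')) x := by
  obtain ⟨c, rfl, hc⟩ := hcomplete u' x
  set Ψ : E × (Fin d → ℂ) → E := fun p => timeOneMap (linComb g p.2) p.1
  have hΨeq : Ψ = fun p => (timeOneMap (paramField g) p).1 := by
    ext1 p
    rw [timeOneMap_paramField hg hcomplete p.1 p.2]
  have hΨ : Differentiable ℂ Ψ := hΨeq ▸ (timeOneMap_differentiable (contDiff_paramField hg)
    (isCompleteField_paramField hcomplete)).fst
  have hcurve : IsIntegralCurve (fun t : ℝ => Ψ (c t, t • u)) (fun _ => linComb g (u + u')) := by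
    intro t
    have hd : HasDerivAt (fun t : ℝ => Ψ (c t, t • u))
        (fderiv ℂ Ψ (c t, t • u) (linComb g u' (c t), u)) t := by
      have h1 : HasDerivAt (fun t : ℝ => (c t, t • u)) (linComb g u' (c t), u) t := by
        refine (hc t).prodMk ?_
        simpa using (hasDerivAt_id t).smul_const u
      exact ((hΨ _).hasFDerivAt.restrictScalars ℝ).comp_hasDerivAt t h1
    refine hd.congr_deriv ?_
    have hsplit : ((linComb g u' (c t), u) : E × (Fin d → ℂ)) =
        (linComb g u' (c t), 0) + (0, u) := by simp
    have hx : fderiv ℂ Ψ (c t, t • u) (linComb g u' (c t), 0) =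
        linComb g u' (Ψ (c t, t • u)) := by
      have hcomp : HasFDerivAt (fun y => Ψ (y, t • u))
          ((fderiv ℂ Ψ (c t, t • u)).comp (ContinuousLinearMap.inl ℂ E (Fin d → ℂ))) (c t) :=
        (hΨ _).hasFDerivAt.comp (c t) (hasFDerivAt_prodMk_left (c t) (t • u))
      have h0 := apply_timeOneMap_of_lieBracket_eq (μ := 0) (contDiff_linComb hg (t • u))
        (hcomplete (t • u)) (contDiff_linComb hg u')
        (by rw [lieBracket_linComb_eq_zero hg hcomm]; simp) (c t)
      rw [Complex.exp_zero, one_smul] at h0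
      have h2 : fderiv ℂ (timeOneMap (linComb g (t • u))) (c t) = _ := hcomp.fderiv
      rw [h2] at h0
      simpa using h0.symm
    have hu : fderiv ℂ Ψ (c t, t • u) (0, u) = linComb g u (Ψ (c t, t • u)) := by
      obtain ⟨b, hb0, hb⟩ := hcomplete u (c t)
      have hbΨ : ∀ s : ℝ, Ψ (c t, s • u) = b s := fun s => by
        rw [← timeOneMap_linComb_smul hg hb s, hb0]
      have h1 : HasDerivAt (fun s : ℝ => Ψ (c t, s • u)) (fderiv ℂ Ψ (c t, t • u) (0, u)) t := by
        have h1 : HasDerivAt (fun s : ℝ => (c t, s • u)) ((0 : E), u) t := by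
          refine (hasDerivAt_const t (c t)).prodMk ?_
          simpa using (hasDerivAt_id t).smul_const u
        exact ((hΨ _).hasFDerivAt.restrictScalars ℝ).comp_hasDerivAt t h1
      have h2 := hb t
      rw [hbΨ]
      exact h1.unique (h2.congr_of_eventuallyEq (Filter.Eventually.of_forall hbΨ))
    rw [hsplit, map_add, hx, hu]
    simp [linComb, add_smul, Finset.sum_add_distrib, add_comm]
  have h1 := timeOneMap_eq ((contDiff_linComb hg _).of_le (by simp)) hcurve
  rw [timeOneMap_eq ((contDiff_linComb hg _).of_le (by simp)) hc]
  simpa [Ψ, timeOneMap_linComb_zero] using h1.symm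

end CommutingFlows

/-! ### Exponential polynomials and the lifted coefficients -/

section ExponentialPolynomials

open Polynomial

variable {A : Type*}

/-- Exponential polynomials `∑ p_ℓ(τ) E^ℓ`, with formal exponentials `E^ℓ`, `ℓ ∈ A`. -/
abbrev ExpPoly (A : Type*) := AddMonoidAlgebra ℂ[X] A

namespace ExpPoly

/-- The derivation with `∂ τ = 1` and `∂ E^ℓ = κ ℓ • E^ℓ`, as a linear map. -/
noncomputable def derivLinear (κ : A → ℂ) : ExpPoly A →ₗ[ℂ] ExpPoly A where
  toFun f := f.coeff.sum fun ℓ p => .single ℓ (derivative p + C (κ ℓ) * p)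
  map_add' f f' := by
    rw [AddMonoidAlgebra.coeff_add, Finsupp.sum_add_index'] <;> intros <;>
      simp [mul_add, add_add_add_comm]
  map_smul' c f := by
    rw [AddMonoidAlgebra.coeff_smul, Finsupp.sum_smul_index' (by simp), RingHom.id_apply,
      Finsupp.smul_sum]
    refine Finsupp.sum_congr fun ℓ _ => ?_
    rw [AddMonoidAlgebra.smul_single, smul_add, derivative_smul, mul_smul_comm]

theorem derivLinear_single (κ : A → ℂ) (ℓ : A) (p : ℂ[X]) :
    derivLinear κ (.single ℓ p) = .single ℓ (derivative p + C (κ ℓ) * p) := by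
  simp [derivLinear]

theorem coeff_derivLinear (κ : A → ℂ) (f : ExpPoly A) (ℓ : A) :
    (derivLinear κ f).coeff ℓ = derivative (f.coeff ℓ) + C (κ ℓ) * f.coeff ℓ := by
  classical
  induction f using AddMonoidAlgebra.induction_linear with
  | zero => simp
  | add f f' hf hf' => simp [hf, hf', mul_add, add_add_add_comm]
  | single a p =>
    rw [derivLinear_single, AddMonoidAlgebra.coeff_single, AddMonoidAlgebra.coeff_single]
    by_cases h : a = ℓ
    · subst h; simp
    · simp [h]

variable [AddCommMonoid A]

/-- The derivation with `∂ τ = 1` and `∂ E^ℓ = κ ℓ • E^ℓ`. -/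
noncomputable def deriv (κ : A →+ ℂ) : Derivation ℂ (ExpPoly A) (ExpPoly A) :=
  Derivation.mk' (derivLinear κ) fun f f' => by
    induction f using AddMonoidAlgebra.induction_linear with
    | zero => simp
    | add f₁ f₂ h₁ h₂ =>
      rw [add_mul, map_add, h₁, h₂, map_add, add_smul, smul_add, add_add_add_comm]
    | single a p =>
      induction f' using AddMonoidAlgebra.induction_linear with
      | zero => simp
      | add f₁ f₂ h₁ h₂ =>
        rw [mul_add, map_add, h₁, h₂, map_add, add_smul, smul_add, add_add_add_comm]
      | single b q =>
        rw [AddMonoidAlgebra.single_mul_single, derivLinear_single, derivLinear_single,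
          derivLinear_single, smul_eq_mul, smul_eq_mul, AddMonoidAlgebra.single_mul_single,
          AddMonoidAlgebra.single_mul_single, add_comm b a, ← AddMonoidAlgebra.single_add,
          derivative_mul, map_add, C_add]
        congr 1
        ring

theorem deriv_single (κ : A →+ ℂ) (ℓ : A) (p : ℂ[X]) :
    deriv κ (.single ℓ p) = .single ℓ (derivative p + C (κ ℓ) * p) :=
  derivLinear_single _ _ _

/-- Evaluation at `τ` and at `E^ℓ = exp (z ℓ)`. -/
noncomputable def eval (τ : ℂ) (z : A →+ ℂ) : ExpPoly A →ₐ[ℂ] ℂ :=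
  AddMonoidAlgebra.liftNCAlgHom (Polynomial.aeval τ)
    { toFun := fun ℓ => Complex.exp (z ℓ.toAdd)
      map_one' := by simp
      map_mul' := fun a b => by simp [Complex.exp_add] }
    fun _ _ => Commute.all _ _

theorem eval_single (τ : ℂ) (z : A →+ ℂ) (ℓ : A) (p : ℂ[X]) :
    eval τ z (.single ℓ p) = p.eval τ * Complex.exp (z ℓ) := by
  simp [eval, Polynomial.aeval_def, Polynomial.eval₂_eq_eval_map]

/-- The translation `τ ↦ τ + τ'`, `E^ℓ ↦ exp (z' ℓ) E^ℓ`. -/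
noncomputable def translate (τ' : ℂ) (z' : A →+ ℂ) : ExpPoly A →ₐ[ℂ] ExpPoly A :=
  AddMonoidAlgebra.liftNCAlgHom
    (AddMonoidAlgebra.singleZeroAlgHom.comp (Polynomial.aeval (X + C τ')))
    { toFun := fun ℓ => .single ℓ.toAdd (C (Complex.exp (z' ℓ.toAdd)))
      map_one' := by simp [AddMonoidAlgebra.one_def]
      map_mul' := fun a b => by simp [Complex.exp_add] }
    fun _ _ => Commute.all _ _

theorem translate_single (τ' : ℂ) (z' : A →+ ℂ) (ℓ : A) (p : ℂ[X]) :
    translate τ' z' (.single ℓ p) =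
      .single ℓ (p.comp (X + C τ') * C (Complex.exp (z' ℓ))) := by
  simp [translate, Polynomial.aeval_def, Polynomial.comp, Polynomial.algebraMap_eq]

theorem eval_translate (τ τ' : ℂ) (z z' : A →+ ℂ) (f : ExpPoly A) :
    eval τ z (translate τ' z' f) = eval (τ + τ') (z + z') f := by
  induction f using AddMonoidAlgebra.induction_linear with
  | zero => simp
  | add f f' hf hf' => simp [hf, hf']
  | single a p =>
    rw [translate_single, eval_single, eval_single]
    simp [Complex.exp_add]
    ring

theorem deriv_translate (κ : A →+ ℂ) (τ' : ℂ) (z' : A →+ ℂ) (f : ExpPoly A) :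
    deriv κ (translate τ' z' f) = translate τ' z' (deriv κ f) := by
  induction f using AddMonoidAlgebra.induction_linear with
  | zero => simp
  | add f f' hf hf' => simp [hf, hf']
  | single a p =>
    rw [translate_single, deriv_single, deriv_single, translate_single]
    simp [derivative_comp, add_mul, mul_assoc]

/-- Componentwise the equation is p' + κ_ℓ p = 0. For κ_ℓ ≠ 0 comparing degrees forces p = 0; only
the constant at ℓ = 0 survives, and the value at the origin removes it. This is the uniqueness
principle behind both key properties of γ. -/
theorem eq_zero_of_deriv_eq_zero {κ : A →+ ℂ} (hκ : ∀ ℓ, κ ℓ = 0 ↔ ℓ = 0) {f : ExpPoly A}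
    (hf : deriv κ f = 0) (h0 : eval 0 0 f = 0) : f = 0 := by
  have hcoeff : ∀ ℓ, derivative (f.coeff ℓ) + C (κ ℓ) * f.coeff ℓ = 0 := fun ℓ => by
    rw [← coeff_derivLinear, show derivLinear κ f = 0 from hf]
    rfl
  have hne : ∀ ℓ, ℓ ≠ 0 → f.coeff ℓ = 0 := by
    intro ℓ hℓ
    by_contra hp
    have hκℓ : κ ℓ ≠ 0 := (hκ ℓ).not.mpr hℓ
    have h1 := degree_derivative_lt hp
    rw [eq_neg_of_add_eq_zero_left (hcoeff ℓ), degree_neg, degree_C_mul hκℓ] at h1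
    exact lt_irrefl _ h1
  have hsingle : f = .single 0 (f.coeff 0) := by
    ext1
    ext1 ℓ
    by_cases h : ℓ = 0
    · subst h; simp
    · simp [hne ℓ h, Ne.symm h]
  have h2 := hcoeff 0
  rw [(hκ 0).mpr rfl, C_0, zero_mul, add_zero] at h2
  have h3 := eq_C_of_derivative_eq_zero h2
  rw [hsingle, h3, eval_single] at h0
  have h4 : (f.coeff 0).coeff 0 = 0 := by simpa using h0
  rw [hsingle, h3, h4]
  simp

open Classical in
/-- The coefficients `γ_{0^r w}` as exponential polynomials. -/
noncomputable def gammaAux (κ : A → ℂ) : ℕ → List A → ExpPoly A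
  | r, [] => .single 0 (C ((Nat.factorial r : ℂ)⁻¹) * X ^ r)
  | 0, [ℓ₀] =>
      if ℓ₀ = 0 then gammaAux κ 1 []
      else (κ ℓ₀)⁻¹ • (.single ℓ₀ 1 - 1)
  | r + 1, [ℓ₀] =>
      if ℓ₀ = 0 then gammaAux κ (r + 2) []
      else (κ ℓ₀)⁻¹ • (gammaAux κ (r + 1) [] * .single ℓ₀ 1 - gammaAux κ r [ℓ₀])
  | 0, ℓ₀ :: ℓ₁ :: w =>
      if ℓ₀ = 0 then gammaAux κ 1 (ℓ₁ :: w)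
      else (κ ℓ₀)⁻¹ • (gammaAux κ 0 ((ℓ₀ + ℓ₁) :: w) - gammaAux κ 0 (ℓ₁ :: w))
  | r + 1, ℓ₀ :: ℓ₁ :: w =>
      if ℓ₀ = 0 then gammaAux κ (r + 2) (ℓ₁ :: w)
      else (κ ℓ₀)⁻¹ • (gammaAux κ (r + 1) ((ℓ₀ + ℓ₁) :: w) - gammaAux κ r (ℓ₀ :: ℓ₁ :: w))
termination_by r w => r + 2 * w.length

theorem gammaAux_zero_cons (κ : A → ℂ) (r : ℕ) (w : List A) :
    gammaAux κ r (0 :: w) = gammaAux κ (r + 1) w := by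
  cases r <;> cases w <;> simp [gammaAux]

theorem deriv_gammaAux_nil (κ : A →+ ℂ) (r : ℕ) :
    deriv κ (gammaAux κ (r + 1) []) = gammaAux κ r [] := by
  rw [gammaAux, gammaAux, deriv_single]
  congr 1
  simp only [derivative_C_mul, derivative_X_pow, map_zero, zero_mul, add_zero,
    Nat.factorial_succ, Nat.add_sub_cancel, ← mul_assoc, ← C_mul]
  congr 2
  have : ((r : ℂ) + 1) ≠ 0 := by exact_mod_cast r.succ_ne_zero
  push_cast
  field_simp

/-- The recursion consumes letters from the front while ∂ strips the last one, so the two commute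
until one letter precedes `ℓ`. There `ℓ₀ + ℓ` becomes the last letter, and E^{ℓ₀+ℓ} = E^ℓ E^{ℓ₀}
reproduces the recursion for the shorter word. -/
theorem deriv_gammaAux_append_singleton (κ : A →+ ℂ) (hκ : ∀ ℓ, κ ℓ = 0 ↔ ℓ = 0) (ℓ : A) :
    ∀ (r : ℕ) (w : List A),
      deriv κ (gammaAux κ r (w ++ [ℓ])) = .single ℓ 1 * gammaAux κ r w
  | r, [] => by
    by_cases h : ℓ = 0
    · subst h
      rw [List.nil_append, gammaAux_zero_cons, deriv_gammaAux_nil, ← AddMonoidAlgebra.one_def,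
        one_mul]
    · have hne : κ ℓ ≠ 0 := (hκ ℓ).not.mpr h
      have hE : deriv κ (.single ℓ 1) = κ ℓ • AddMonoidAlgebra.single ℓ 1 := by
        rw [deriv_single, AddMonoidAlgebra.smul_single]
        simp [smul_eq_C_mul]
      match r with
      | 0 =>
        rw [List.nil_append, gammaAux.eq_2, if_neg h, Derivation.map_smul, map_sub, hE,
          Derivation.map_one_eq_zero, sub_zero, inv_smul_smul₀ hne, gammaAux.eq_1]
        simp [← AddMonoidAlgebra.one_def]
      | r + 1 =>
        have ih := deriv_gammaAux_append_singleton κ hκ ℓ r []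
        rw [List.nil_append] at ih
        rw [List.nil_append, gammaAux.eq_3, if_neg h, Derivation.map_smul, map_sub,
          Derivation.leibniz,
          hE, deriv_gammaAux_nil, ih, smul_eq_mul, smul_eq_mul, add_sub_cancel_right,
          mul_smul_comm, inv_smul_smul₀ hne, mul_comm]
  | r, ℓ₀ :: w => by
    by_cases h : ℓ₀ = 0
    · subst h
      rw [List.cons_append, gammaAux_zero_cons, gammaAux_zero_cons,
        deriv_gammaAux_append_singleton κ hκ ℓ (r + 1) w]
    · match r, w with
      | 0, [] =>
        have ih₁ := deriv_gammaAux_append_singleton κ hκ (ℓ₀ + ℓ) 0 []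
        have ih₂ := deriv_gammaAux_append_singleton κ hκ ℓ 0 []
        rw [List.nil_append] at ih₁ ih₂
        rw [List.cons_append, List.nil_append, gammaAux.eq_4, if_neg h, Derivation.map_smul,
          map_sub,
          ih₁, ih₂, gammaAux.eq_1, gammaAux.eq_2, if_neg h, mul_smul_comm, mul_sub]
        simp [add_comm ℓ ℓ₀]
      | r + 1, [] =>
        have ih₁ := deriv_gammaAux_append_singleton κ hκ (ℓ₀ + ℓ) (r + 1) []
        have ih₂ := deriv_gammaAux_append_singleton κ hκ ℓ r [ℓ₀]
        rw [List.nil_append] at ih₁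
        rw [List.cons_append, List.nil_append] at ih₂
        rw [List.cons_append, List.nil_append, gammaAux.eq_5, if_neg h, Derivation.map_smul,
          map_sub,
          ih₁, ih₂, gammaAux.eq_3, if_neg h, mul_smul_comm, mul_sub,
          mul_left_comm, AddMonoidAlgebra.single_mul_single, add_comm ℓ ℓ₀, mul_one, mul_comm]
      | 0, ℓ₁ :: w =>
        have ih₁ := deriv_gammaAux_append_singleton κ hκ ℓ 0 ((ℓ₀ + ℓ₁) :: w)
        have ih₂ := deriv_gammaAux_append_singleton κ hκ ℓ 0 (ℓ₁ :: w)
        rw [List.cons_append] at ih₁ ih₂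
        rw [List.cons_append, List.cons_append, gammaAux, if_neg h, Derivation.map_smul, map_sub,
          ih₁, ih₂, gammaAux.eq_4, if_neg h, mul_smul_comm, mul_sub]
      | r + 1, ℓ₁ :: w =>
        have ih₁ := deriv_gammaAux_append_singleton κ hκ ℓ (r + 1) ((ℓ₀ + ℓ₁) :: w)
        have ih₂ := deriv_gammaAux_append_singleton κ hκ ℓ r (ℓ₀ :: ℓ₁ :: w)
        rw [List.cons_append] at ih₁ ih₂
        rw [List.cons_append] at ih₂
        rw [List.cons_append, List.cons_append, gammaAux, if_neg h, Derivation.map_smul, map_sub,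
          ih₁, ih₂, gammaAux.eq_5, if_neg h, mul_smul_comm, mul_sub]
-- A letter weighs 2, so that trading a leading zero for one more unit of `r` still decreases the
-- measure.
termination_by r w => r + 2 * w.length

end ExpPoly

end ExponentialPolynomials

/-! ### Convolution identity for γ -/

section GammaCoefficients

variable {A : Type*} [AddCommMonoid A] {d : ℕ} {ν : Fin d → A → ℂ}

/-- `ℓ ↦ ν_ℓ^u` as an additive homomorphism. -/
noncomputable def eigenvalueHom (hadd : ∀ j ℓ ℓ', ν j (ℓ + ℓ') = ν j ℓ + ν j ℓ')
    (u : Fin d → ℂ) : A →+ ℂ :=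
  AddMonoidHom.mk' (M := A) (G := ℂ) (eigenvalue ν u) fun ℓ ℓ' => by
    simp [eigenvalue, hadd, mul_add, Finset.sum_add_distrib]

theorem eigenvalueHom_apply (hadd : ∀ j ℓ ℓ', ν j (ℓ + ℓ') = ν j ℓ + ν j ℓ')
    (u : Fin d → ℂ) (ℓ : A) : eigenvalueHom hadd u ℓ = eigenvalue ν u ℓ := rfl

/-- The two recursions agree after evaluation: `v` enters only through the denominators, `τ` and `u`
only through the evaluation point. -/
theorem eval_gammaAux (hadd : ∀ j ℓ ℓ', ν j (ℓ + ℓ') = ν j ℓ + ν j ℓ') (v : Fin d → ℂ) (τ : ℝ)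
    (u : Fin d → ℂ) (r : ℕ) (w : List A) :
    ExpPoly.eval τ (eigenvalueHom hadd u) (ExpPoly.gammaAux (eigenvalue ν v) r w) =
      gammaAux ν v τ u r w := by
  have hE : ∀ ℓ : A, ExpPoly.eval τ (eigenvalueHom hadd u) (.single ℓ 1) =
      Complex.exp (eigenvalue ν u ℓ) := fun ℓ => by
    simp [ExpPoly.eval_single, eigenvalueHom_apply]
  induction r, w using ExpPoly.gammaAux.induct with
  | case1 r =>
    rw [ExpPoly.gammaAux, gammaAux, ExpPoly.eval_single]
    simp
    ring
  | case5 =>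
    simp_all [ExpPoly.gammaAux, gammaAux, div_eq_inv_mul]
    left
    simp [ExpPoly.eval_single, eigenvalueHom_apply]
  | _ => simp_all [ExpPoly.gammaAux, gammaAux, div_eq_inv_mul]

/-- `exp (z ℓ₁ + ⋯ + z ℓₙ)` for the word `ℓ₁⋯ℓₙ`. -/
noncomputable def wordExp (z : A → ℂ) (w : List A) : ℂ :=
  Complex.exp (w.map z).sum

theorem eval_zero_gammaAux (κ : A → ℂ) (r : ℕ) (w : List A) (h : 0 < r + w.length) :
    ExpPoly.eval 0 0 (ExpPoly.gammaAux κ r w) = 0 := by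
  induction r, w using ExpPoly.gammaAux.induct with
  | case1 r =>
    rw [ExpPoly.gammaAux, ExpPoly.eval_single]
    have : r ≠ 0 := by simpa [Nat.pos_iff_ne_zero] using h
    simp [this]
  | case3 ℓ hℓ =>
    rw [ExpPoly.gammaAux.eq_2, if_neg hℓ]
    simp [ExpPoly.eval_single]
  | case5 =>
    simp_all [ExpPoly.gammaAux]
    right
    simp [ExpPoly.eval_single]
  | _ => simp_all [ExpPoly.gammaAux]

/-- The coefficients `γ_w` as exponential polynomials. -/
noncomputable def ExpPoly.gamma (κ : A → ℂ) (w : List A) : ExpPoly A :=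
  ExpPoly.gammaAux κ 0 w

theorem ExpPoly.gamma_nil (κ : A → ℂ) : ExpPoly.gamma κ [] = 1 := by
  simp [ExpPoly.gamma, ExpPoly.gammaAux, AddMonoidAlgebra.one_def]

theorem ExpPoly.deriv_gamma_append_singleton (κ : A →+ ℂ) (hκ : ∀ ℓ, κ ℓ = 0 ↔ ℓ = 0) (w : List A)
    (ℓ : A) : ExpPoly.deriv κ (ExpPoly.gamma κ (w ++ [ℓ])) = .single ℓ 1 * ExpPoly.gamma κ w :=
  ExpPoly.deriv_gammaAux_append_singleton κ hκ ℓ 0 w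

theorem ExpPoly.eval_zero_gamma (κ : A → ℂ) {w : List A} (hw : w ≠ []) :
    ExpPoly.eval 0 0 (ExpPoly.gamma κ w) = 0 :=
  eval_zero_gammaAux κ 0 w (by simpa using List.length_pos_iff.mpr hw)

theorem eval_gamma (hadd : ∀ j ℓ ℓ', ν j (ℓ + ℓ') = ν j ℓ + ν j ℓ') (v : Fin d → ℂ) (τ : ℝ)
    (u : Fin d → ℂ) (w : List A) :
    ExpPoly.eval τ (eigenvalueHom hadd u) (ExpPoly.gamma (eigenvalue ν v) w) = gamma ν v τ u w :=
  eval_gammaAux hadd v τ u 0 w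

/-- Translation commutes with ∂, so removing the last letter by differentiation reduces the identity
to the shorter word; the splitting with empty suffix is the constant of integration. -/
theorem ExpPoly.translate_gamma (κ : A →+ ℂ) (hκ : ∀ ℓ, κ ℓ = 0 ↔ ℓ = 0) (τ' : ℂ) (z' : A →+ ℂ)
    (w : List A) :
    ExpPoly.translate τ' z' (ExpPoly.gamma κ w) =
      ∑ i ∈ Finset.range (w.length + 1),
        (ExpPoly.eval τ' z' (ExpPoly.gamma κ (w.take i)) * wordExp z' (w.drop i)) •
          ExpPoly.gamma κ (w.drop i) := by
  induction w using List.reverseRecOn with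
  | nil => simp [ExpPoly.gamma_nil, wordExp]
  | append_singleton w ℓ ih =>
    have hsum : ∑ i ∈ Finset.range ((w ++ [ℓ]).length + 1),
        (ExpPoly.eval τ' z' (ExpPoly.gamma κ ((w ++ [ℓ]).take i)) *
          wordExp z' ((w ++ [ℓ]).drop i)) • ExpPoly.gamma κ ((w ++ [ℓ]).drop i) =
        ∑ i ∈ Finset.range (w.length + 1),
          (ExpPoly.eval τ' z' (ExpPoly.gamma κ (w.take i)) *
            (wordExp z' (w.drop i) * Complex.exp (z' ℓ))) • ExpPoly.gamma κ (w.drop i ++ [ℓ]) +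
        ExpPoly.eval τ' z' (ExpPoly.gamma κ (w ++ [ℓ])) • 1 := by
      rw [List.length_append, List.length_singleton, Finset.sum_range_succ]
      congr 1
      · refine Finset.sum_congr rfl fun i hi => ?_
        have hi' : i ≤ w.length := by simpa [Nat.lt_succ_iff] using hi
        rw [List.take_append_of_le_length hi', List.drop_append_of_le_length hi']
        simp [wordExp, Complex.exp_add]
      · rw [List.take_of_length_le (by simp), List.drop_of_length_le (by simp)]
        simp [wordExp, ExpPoly.gamma_nil]
    rw [hsum, ← sub_eq_zero]
    refine ExpPoly.eq_zero_of_deriv_eq_zero hκ ?_ ?_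
    · rw [map_sub, ExpPoly.deriv_translate, ExpPoly.deriv_gamma_append_singleton κ hκ, map_mul, ih,
        ExpPoly.translate_single, map_add, map_sum, Derivation.map_smul,
        Derivation.map_one_eq_zero, smul_zero, add_zero, Finset.mul_sum, sub_eq_zero]
      refine Finset.sum_congr rfl fun i _ => ?_
      have hE : (AddMonoidAlgebra.single ℓ (Polynomial.comp 1 (Polynomial.X + Polynomial.C τ') *
          Polynomial.C (Complex.exp (z' ℓ))) : ExpPoly A) =
          Complex.exp (z' ℓ) • AddMonoidAlgebra.single ℓ 1 := by
        rw [AddMonoidAlgebra.smul_single]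
        simp [Polynomial.smul_eq_C_mul]
      rw [Derivation.map_smul, ExpPoly.deriv_gamma_append_singleton κ hκ, hE, smul_mul_assoc,
        mul_smul_comm, smul_smul]
      congr 1
      ring
    · rw [map_sub, ExpPoly.eval_translate, zero_add, zero_add, map_add, map_sum,
        Finset.sum_eq_zero fun i _ => ?_]
      · simp
      · rw [map_smul, ExpPoly.eval_zero_gamma κ (by simp), smul_zero]

/-- The convolution identity for the coefficients `γ_w`. -/
theorem gamma_add (hadd : ∀ j ℓ ℓ', ν j (ℓ + ℓ') = ν j ℓ + ν j ℓ') {v : Fin d → ℂ}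
    (hnonres : ∀ ℓ, eigenvalue ν v ℓ = 0 ↔ ℓ = 0) (τ τ' : ℝ) (u u' : Fin d → ℂ) (w : List A) :
    gamma ν v (τ + τ') (u + u') w =
      ∑ i ∈ Finset.range (w.length + 1), gamma ν v τ' u' (w.take i) *
        (wordExp (eigenvalue ν u') (w.drop i) * gamma ν v τ u (w.drop i)) := by
  have h := congrArg (ExpPoly.eval τ (eigenvalueHom hadd u))
    (ExpPoly.translate_gamma (eigenvalueHom hadd v) hnonres τ' (eigenvalueHom hadd u') w)
  have hz : eigenvalueHom hadd u + eigenvalueHom hadd u' = eigenvalueHom hadd (u + u') := by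
    ext ℓ
    simp [eigenvalueHom_apply, eigenvalue, add_mul, Finset.sum_add_distrib]
  rw [ExpPoly.eval_translate, hz, ← Complex.ofReal_add, map_sum] at h
  simp only [map_smul, smul_eq_mul, mul_assoc] at h
  have hκ : (eigenvalueHom hadd v : A → ℂ) = eigenvalue ν v := rfl
  have hκ' : (eigenvalueHom hadd u' : A → ℂ) = eigenvalue ν u' := rfl
  simpa only [hκ, hκ', eval_gamma] using h

end GammaCoefficients

/-! ### Iterated Lie derivatives -/

section LieWords

variable {A : Type*} {E V : Type*} [NormedAddCommGroup E] [NormedSpace ℂ E]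
  [NormedAddCommGroup V] [NormedSpace ℂ V] {f : A → E → E}

/-- The iterated Lie derivative `f_{ℓ₁}(f_{ℓ₂}(⋯ f_{ℓₙ}(h)))` along the word `ℓ₁⋯ℓₙ`. -/
noncomputable def lieWord (f : A → E → E) (w : List A) (h : E → V) : E → V :=
  w.foldr (fun ℓ k y => fderiv ℂ k y (f ℓ y)) h

theorem lieWord_nil (h : E → V) : lieWord f [] h = h := rfl

theorem lieWord_cons (ℓ : A) (w : List A) (h : E → V) :
    lieWord f (ℓ :: w) h = fun y => fderiv ℂ (lieWord f w h) y (f ℓ y) := rfl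

theorem lieWord_append (w w' : List A) (h : E → V) :
    lieWord f (w ++ w') h = lieWord f w (lieWord f w' h) :=
  List.foldr_append

theorem wordBasis_eq_lieWord (w : List A) : wordBasis f w = lieWord f w id := by
  induction w with
  | nil => rfl
  | cons ℓ w ih =>
    cases w with
    | nil => ext1 y; simp [wordBasis, lieWord]
    | cons ℓ' w => rw [wordBasis, lieWord_cons, ih]

theorem contDiff_lieWord (hf : ∀ ℓ, ContDiff ℂ ∞ (f ℓ)) (w : List A) {h : E → V}
    (hh : ContDiff ℂ ∞ h) : ContDiff ℂ ∞ (lieWord f w h) := by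
  induction w with
  | nil => exact hh
  | cons ℓ w ih => exact contDiff_fderiv_apply ih (hf ℓ)

theorem lieWord_const {w : List A} (hw : w ≠ []) (c : V) :
    lieWord f w (fun _ => c) = fun _ => 0 := by
  induction w with
  | nil => exact absurd rfl hw
  | cons ℓ w ih =>
    rw [lieWord_cons]
    by_cases h : w = []
    · subst h; simp [lieWord_nil]
    · rw [ih h]; simp

theorem lieWord_sum (hf : ∀ ℓ, ContDiff ℂ ∞ (f ℓ)) {ι : Type*} (s : Finset ι) {h : ι → E → V}
    (hh : ∀ i ∈ s, ContDiff ℂ ∞ (h i)) (w : List A) :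
    lieWord f w (fun y => ∑ i ∈ s, h i y) = fun y => ∑ i ∈ s, lieWord f w (h i) y := by
  induction w with
  | nil => rfl
  | cons ℓ w ih =>
    ext1 y
    rw [lieWord_cons, ih]
    beta_reduce
    rw [fderiv_fun_sum fun i hi =>
      (contDiff_lieWord hf w (hh i hi)).differentiable (by simp) y, sum_apply]
    rfl

theorem lieWord_add (hf : ∀ ℓ, ContDiff ℂ ∞ (f ℓ)) {h k : E → V} (hh : ContDiff ℂ ∞ h)
    (hk : ContDiff ℂ ∞ k) (w : List A) :
    lieWord f w (fun y => h y + k y) = fun y => lieWord f w h y + lieWord f w k y := by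
  induction w with
  | nil => rfl
  | cons ℓ w ih =>
    ext1 y
    rw [lieWord_cons, ih]
    beta_reduce
    rw [fderiv_fun_add ((contDiff_lieWord hf w hh).differentiable (by simp) y)
      ((contDiff_lieWord hf w hk).differentiable (by simp) y)]
    rfl

theorem lieWord_clm_comp (hf : ∀ ℓ, ContDiff ℂ ∞ (f ℓ)) {V' : Type*} [NormedAddCommGroup V']
    [NormedSpace ℂ V'] (T : V →L[ℂ] V') {h : E → V} (hh : ContDiff ℂ ∞ h) (w : List A) :
    lieWord f w (fun y => T (h y)) = fun y => T (lieWord f w h y) := by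
  induction w with
  | nil => rfl
  | cons ℓ w ih =>
    ext1 y
    rw [lieWord_cons, ih]
    have := (T.hasFDerivAt.comp y
      ((contDiff_lieWord hf w hh).differentiable (by simp) y).hasFDerivAt).fderiv
    exact congrArg (fun L : E →L[ℂ] V' => L (f ℓ y)) this

end LieWords

/-! ### Words of a given multidegree -/

section WordContents

variable {A : Type*}

theorem wordsOfContent_zero : wordsOfContent (0 : A →₀ ℕ) = {[]} := by
  classical
  ext w
  rw [mem_wordsOfContent, Finset.mem_singleton]
  simp [List.count_eq_zero, List.eq_nil_iff_forall_not_mem]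

theorem nil_mem_wordsOfContent_iff {m : A →₀ ℕ} : [] ∈ wordsOfContent m ↔ m = 0 := by
  classical
  simp [mem_wordsOfContent, Finsupp.ext_iff, eq_comm]

theorem length_of_mem_wordsOfContent {m : A →₀ ℕ} {w : List A} (h : w ∈ wordsOfContent m) :
    w.length = m.degree := by
  classical
  rw [wordsOfContent, Multiset.mem_toFinset, Multiset.mem_lists_iff] at h
  have := congrArg Multiset.card h
  rw [Finsupp.card_toMultiset] at this
  exact this.symm

/-- A sum over the words of a given content, by last letters. -/
theorem sum_wordsOfContent {M : Type*} [AddCommMonoid M] {m : A →₀ ℕ} (hm : m ≠ 0)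
    {S : Finset A} (hS : m.support ⊆ S) (G : List A → M) :
    ∑ w ∈ wordsOfContent m, G w = ∑ ℓ ∈ S,
      if Finsupp.single ℓ 1 ≤ m then
        ∑ w ∈ wordsOfContent (m - Finsupp.single ℓ 1), G (w ++ [ℓ]) else 0 := by
  classical
  rw [← Finset.sum_filter, Finset.sum_sigma']
  symm
  refine Finset.sum_bij (fun x _ => x.2 ++ [x.1]) ?_ ?_ ?_ ?_
  · rintro ⟨ℓ, w⟩ h
    rw [Finset.mem_sigma, Finset.mem_filter] at h
    obtain ⟨⟨-, hle⟩, hw⟩ := h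
    rw [mem_wordsOfContent] at hw ⊢
    intro a
    have := hw a
    have h1 := hle a
    rw [List.count_append, this, Finsupp.tsub_apply]
    rw [Finsupp.single_apply] at h1 ⊢
    rw [List.count_singleton']
    split_ifs at * <;> omega
  · rintro ⟨ℓ, w⟩ - ⟨ℓ', w'⟩ - h
    obtain ⟨rfl, h2⟩ := List.append_inj' h rfl
    simpa using h2
  · intro w hw
    rcases List.eq_nil_or_concat w with rfl | ⟨w', ℓ, rfl⟩
    · exact absurd (nil_mem_wordsOfContent_iff.mp hw) hm
    · rw [mem_wordsOfContent] at hw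
      have hpos : 1 ≤ m ℓ := by rw [← hw ℓ]; simp
      refine ⟨⟨ℓ, w'⟩, ?_, by simp⟩
      rw [Finset.mem_sigma, Finset.mem_filter]
      refine ⟨⟨hS (Finsupp.mem_support_iff.mpr (Nat.one_le_iff_ne_zero.mp hpos)),
        Finsupp.single_le_iff.mpr hpos⟩, ?_⟩
      rw [mem_wordsOfContent]
      intro a
      have := hw a
      rw [List.concat_eq_append, List.count_append, List.count_singleton'] at this
      rw [Finsupp.tsub_apply, Finsupp.single_apply]
      change w'.count a = _
      split_ifs at * <;> omega
  · intros; rfl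

open Classical in
/-- Splitting words in two corresponds to splitting their contents. -/
theorem sum_wordsOfContent_splits {M : Type*} [AddCommMonoid M] (m : A →₀ ℕ)
    (G : List A → List A → M) :
    ∑ w ∈ wordsOfContent m, ∑ i ∈ Finset.range (w.length + 1), G (w.take i) (w.drop i) =
      ∑ np ∈ Finset.HasAntidiagonal.antidiagonal m,
        ∑ w ∈ wordsOfContent np.2, ∑ w' ∈ wordsOfContent np.1, G w w' := by
  simp only [← Finset.sum_product', Finset.sum_sigma']
  symm
  refine Finset.sum_bij (fun x _ => ⟨x.2.1 ++ x.2.2, x.2.1.length⟩) ?_ ?_ ?_ ?_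
  · rintro ⟨⟨n, p⟩, w, w'⟩ h
    simp only [Finset.mem_sigma, Finset.mem_product, Finset.HasAntidiagonal.mem_antidiagonal] at h
    obtain ⟨rfl, hw, hw'⟩ := h
    rw [mem_wordsOfContent] at hw hw'
    simp [mem_wordsOfContent, hw, hw', add_comm]
  · rintro ⟨⟨n, p⟩, w, w'⟩ h ⟨⟨n', p'⟩, v, v'⟩ h' heq
    simp only [Finset.mem_sigma, Finset.mem_product, Finset.HasAntidiagonal.mem_antidiagonal,
      mem_wordsOfContent] at h h'
    simp only [Sigma.mk.injEq, heq_eq_eq] at heq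
    obtain ⟨rfl, rfl⟩ := List.append_inj heq.1 heq.2
    have h1 : n = n' := Finsupp.ext fun a => by rw [← h.2.2 a, ← h'.2.2 a]
    have h2 : p = p' := Finsupp.ext fun a => by rw [← h.2.1 a, ← h'.2.1 a]
    rw [h1, h2]
  · rintro ⟨w, i⟩ h
    simp only [Finset.mem_sigma, Finset.mem_range, Nat.lt_succ_iff] at h
    refine ⟨⟨(Multiset.toFinsupp (w.drop i : Multiset A),
      Multiset.toFinsupp (w.take i : Multiset A)),
      (w.take i, w.drop i)⟩, ?_, ?_⟩
    · simp only [Finset.mem_sigma, Finset.mem_product, Finset.HasAntidiagonal.mem_antidiagonal,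
        mem_wordsOfContent]
      refine ⟨Finsupp.ext fun a => ?_, fun a => by simp, fun a => by simp⟩
      rw [← (mem_wordsOfContent _ _).mp h.1 a]
      simp only [Finsupp.add_apply, Multiset.toFinsupp_apply, Multiset.coe_count]
      rw [add_comm, ← List.count_append, List.take_append_drop]
    · simp [h.2]
  · rintro ⟨⟨n, p⟩, w, w'⟩ h
    simp

end WordContents

/-! ### Multiplicative action on functions -/

section LieSeries

open MvPowerSeries

variable {A : Type*} {E : Type*} [NormedAddCommGroup E] [NormedSpace ℂ E] {f : A → E → E}
  {R : Type*} [CommRing R] [Algebra ℂ R]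

/-- The formal series `∑_w β_w f_w(h)(x)` of a function `h`. -/
noncomputable def lieSeries (f : A → E → E) (β : List A → R) (h : E → ℂ) (x : E) :
    MvPowerSeries A R :=
  fun m => ∑ w ∈ wordsOfContent m, lieWord f w h x • β w

theorem coeff_lieSeries (β : List A → R) (h : E → ℂ) (x : E) (m : A →₀ ℕ) :
    coeff m (lieSeries f β h x) = ∑ w ∈ wordsOfContent m, lieWord f w h x • β w := rfl

theorem map_lieSeries {R' : Type*} [CommRing R'] [Algebra ℂ R'] (φ : R →ₐ[ℂ] R') (β : List A → R)
    (h : E → ℂ) (x : E) :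
    MvPowerSeries.map (φ : R →+* R') (lieSeries f β h x) = lieSeries f (fun w => φ (β w)) h x := by
  ext m
  rw [coeff_map, coeff_lieSeries, coeff_lieSeries]
  simp

theorem lieSeries_add (hf : ∀ ℓ, ContDiff ℂ ∞ (f ℓ)) (β : List A → R) {h k : E → ℂ}
    (hh : ContDiff ℂ ∞ h) (hk : ContDiff ℂ ∞ k) (x : E) :
    lieSeries f β (fun y => h y + k y) x = lieSeries f β h x + lieSeries f β k x := by
  ext m
  simp only [map_add, coeff_lieSeries, lieWord_add hf hh hk, add_smul, Finset.sum_add_distrib]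

/-- The last letter, which `δ` removes, acts first on `h`. The free index set `S` lets the two
factors of a product be summed over the same letters. -/
theorem deriv_coeff_lieSeries (δ : Derivation ℂ R R) (e : A → R) {β : List A → R}
    (hβ0 : β [] = 1) (hβ : ∀ w ℓ, δ (β (w ++ [ℓ])) = e ℓ * β w) (h : E → ℂ) (x : E)
    {m : A →₀ ℕ} {S : Finset A} (hS : m.support ⊆ S) :
    δ (coeff m (lieSeries f β h x)) = ∑ ℓ ∈ S, coeff m (monomial (Finsupp.single ℓ 1) (e ℓ) *
      lieSeries f β (fun y => fderiv ℂ h y (f ℓ y)) x) := by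
  classical
  simp only [coeff_monomial_mul]
  by_cases hm : m = 0
  · subst hm
    rw [coeff_lieSeries, wordsOfContent_zero, Finset.sum_singleton, hβ0, Derivation.map_smul,
      Derivation.map_one_eq_zero, smul_zero, Finset.sum_eq_zero]
    intro ℓ _
    rw [if_neg (by simp)]
  · rw [coeff_lieSeries, sum_wordsOfContent hm hS, map_sum]
    refine Finset.sum_congr rfl fun ℓ _ => ?_
    split_ifs
    · rw [map_sum, coeff_lieSeries, Finset.mul_sum]
      refine Finset.sum_congr rfl fun w _ => ?_
      rw [Derivation.map_smul, hβ, lieWord_append, mul_smul_comm]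
      rfl
    · exact map_zero δ

/-- Word series whose coefficients satisfy a differential recursion with unique solutions act
multiplicatively on functions. -/
theorem lieSeries_mul_of_derivation (hf : ∀ ℓ, ContDiff ℂ ∞ (f ℓ)) (δ : Derivation ℂ R R)
    (ε : R →ₐ[ℂ] ℂ) (hker : ∀ r, δ r = 0 → ε r = 0 → r = 0) (e : A → R) {β : List A → R}
    (hβ0 : β [] = 1) (hβ : ∀ w ℓ, δ (β (w ++ [ℓ])) = e ℓ * β w) (hε : ∀ w, w ≠ [] → ε (β w) = 0)
    {a b : E → ℂ} (ha : ContDiff ℂ ∞ a) (hb : ContDiff ℂ ∞ b) (x : E) :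
    lieSeries f β (fun y => a y * b y) x = lieSeries f β a x * lieSeries f β b x := by
  classical
  have hεm : ∀ (h : E → ℂ) (m : A →₀ ℕ), m ≠ 0 → ε (coeff m (lieSeries f β h x)) = 0 := by
    intro h m hm
    rw [coeff_lieSeries, map_sum, Finset.sum_eq_zero]
    intro w hw
    rw [map_smul, hε w, smul_zero]
    rintro rfl
    exact hm (nil_mem_wordsOfContent_iff.mp hw)
  -- Applying `δ` lowers the degree by one but replaces `a` or `b` by a Lie derivative, so the
  -- induction on degree runs over all pairs of functions.
  suffices H : ∀ (n : ℕ) (a b : E → ℂ), ContDiff ℂ ∞ a → ContDiff ℂ ∞ b → ∀ m : A →₀ ℕ,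
      m.degree = n → coeff m (lieSeries f β (fun y => a y * b y) x) =
        coeff m (lieSeries f β a x * lieSeries f β b x) by
    ext m
    exact H _ a b ha hb m rfl
  intro n
  induction n using Nat.strong_induction_on with
  | _ n ih =>
  intro a b ha hb m hmn
  by_cases hm : m = 0
  · subst hm
    simp [coeff_mul, coeff_lieSeries, wordsOfContent_zero, lieWord_nil, hβ0, mul_smul]
    exact smul_comm _ _ _
  have hda : ∀ ℓ, ContDiff ℂ ∞ fun y => fderiv ℂ a y (f ℓ y) :=
    fun ℓ => contDiff_fderiv_apply ha (hf ℓ)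
  have hdb : ∀ ℓ, ContDiff ℂ ∞ fun y => fderiv ℂ b y (f ℓ y) :=
    fun ℓ => contDiff_fderiv_apply hb (hf ℓ)
  rw [← sub_eq_zero]
  refine hker _ ?_ ?_
  · have hleib : ∀ ℓ, (fun y => fderiv ℂ (fun y => a y * b y) y (f ℓ y)) =
        fun y => fderiv ℂ a y (f ℓ y) * b y + a y * fderiv ℂ b y (f ℓ y) := fun ℓ => by
      ext1 y
      rw [fderiv_fun_mul (ha.differentiable (by simp) y) (hb.differentiable (by simp) y)]
      simp
      ring
    have hprod : δ (coeff m (lieSeries f β a x * lieSeries f β b x)) =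
        ∑ ℓ ∈ m.support, (coeff m (monomial (Finsupp.single ℓ 1) (e ℓ) *
          (lieSeries f β (fun y => fderiv ℂ a y (f ℓ y)) x * lieSeries f β b x +
            lieSeries f β a x * lieSeries f β (fun y => fderiv ℂ b y (f ℓ y)) x))) := by
      simp only [mul_add, map_add, ← mul_assoc]
      simp only [mul_right_comm _ (lieSeries f β a x)]
      simp only [mul_comm _ (lieSeries f β a x)]
      simp only [coeff_mul m (lieSeries f β a x), coeff_mul m _ (lieSeries f β b x)]
      rw [map_sum, Finset.sum_add_distrib, Finset.sum_comm, Finset.sum_comm (s := m.support),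
        ← Finset.sum_add_distrib]
      refine Finset.sum_congr rfl fun pq hpq => ?_
      rw [Finset.HasAntidiagonal.mem_antidiagonal] at hpq
      have h1 : pq.1.support ⊆ m.support :=
        Finsupp.support_mono (hpq ▸ self_le_add_right pq.1 pq.2)
      have h2 : pq.2.support ⊆ m.support :=
        Finsupp.support_mono (hpq ▸ self_le_add_left pq.2 pq.1)
      rw [Derivation.leibniz, deriv_coeff_lieSeries δ e hβ0 hβ a x h1,
        deriv_coeff_lieSeries δ e hβ0 hβ b x h2, smul_eq_mul, smul_eq_mul, Finset.mul_sum,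
        Finset.mul_sum, add_comm]
      congr 1
      exact Finset.sum_congr rfl fun _ _ => mul_comm _ _
    rw [map_sub, hprod, deriv_coeff_lieSeries δ e hβ0 hβ _ x subset_rfl, sub_eq_zero]
    refine Finset.sum_congr rfl fun ℓ _ => ?_
    rw [coeff_monomial_mul, coeff_monomial_mul]
    split_ifs with hle
    · have hdeg : (m - Finsupp.single ℓ 1).degree < n := by
        have := congrArg Finsupp.degree (tsub_add_cancel_of_le hle)
        rw [map_add, Finsupp.degree_single] at this
        omega
      rw [hleib, lieSeries_add hf β ((hda ℓ).mul hb) (ha.mul (hdb ℓ)), map_add, map_add,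
        ih _ hdeg _ _ (hda ℓ) hb _ rfl, ih _ hdeg _ _ ha (hdb ℓ) _ rfl]
    · rfl
  · rw [map_sub, hεm _ m hm, zero_sub, coeff_mul, map_sum, Finset.sum_eq_zero, neg_zero]
    intro pq hpq
    rw [Finset.HasAntidiagonal.mem_antidiagonal] at hpq
    rw [map_mul]
    by_cases hp : pq.1 = 0
    · rw [hεm b pq.2, mul_zero]
      rintro hq
      exact hm (by rw [← hpq, hp, hq, add_zero])
    · rw [hεm a pq.1 hp, zero_mul]

end LieSeries

/-! ### Multiplicativity for γ -/

section GammaSeries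

variable {A : Type*} [AddCommMonoid A] {d : ℕ} {ν : Fin d → A → ℂ}
  {E : Type*} [NormedAddCommGroup E] [NormedSpace ℂ E] {f : A → E → E}

/-- The identity holds over exponential polynomials, where the derivation argument is available, and
survives evaluation because evaluation is a ring homomorphism. -/
theorem lieSeries_gamma_mul (hadd : ∀ j ℓ ℓ', ν j (ℓ + ℓ') = ν j ℓ + ν j ℓ') {v : Fin d → ℂ}
    (hnonres : ∀ ℓ, eigenvalue ν v ℓ = 0 ↔ ℓ = 0) (hf : ∀ ℓ, ContDiff ℂ ∞ (f ℓ)) (τ : ℝ)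
    (u : Fin d → ℂ) {a b : E → ℂ} (ha : ContDiff ℂ ∞ a) (hb : ContDiff ℂ ∞ b) (x : E) :
    lieSeries f (gamma ν v τ u) (fun y => a y * b y) x =
      lieSeries f (gamma ν v τ u) a x * lieSeries f (gamma ν v τ u) b x := by
  have h := lieSeries_mul_of_derivation hf (ExpPoly.deriv (eigenvalueHom hadd v))
    (ExpPoly.eval 0 0) (fun r => ExpPoly.eq_zero_of_deriv_eq_zero hnonres)
    (fun ℓ => .single ℓ 1) (ExpPoly.gamma_nil _)
    (ExpPoly.deriv_gamma_append_singleton _ hnonres)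
    (fun w hw => ExpPoly.eval_zero_gamma _ hw) ha hb x
  have h' := congrArg (MvPowerSeries.map
    (ExpPoly.eval τ (eigenvalueHom hadd u) : ExpPoly A →+* ℂ)) h
  rw [map_mul, map_lieSeries, map_lieSeries, map_lieSeries] at h'
  have hκ : (eigenvalueHom hadd v : A → ℂ) = eigenvalue ν v := rfl
  have hγ : (fun w => ExpPoly.eval τ (eigenvalueHom hadd u)
      (ExpPoly.gamma (eigenvalueHom hadd v) w)) = gamma ν v τ u := by
    ext1 w
    rw [hκ, eval_gamma]
  rwa [hγ] at h'

end GammaSeries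

/-! ### Functions vanishing to finite order -/

section Flatness

variable {ι : Type*} [Fintype ι] {V : Type*} [NormedAddCommGroup V] [NormedSpace ℂ V]

/-- All partial derivatives of `h` of order at most `N` vanish at `x`. -/
def FlatAt {E : Type*} [NormedAddCommGroup E] [NormedSpace ℂ E] : ℕ → (E → V) → E → Prop
  | 0, h, x => h x = 0
  | N + 1, h, x => h x = 0 ∧ ∀ v, FlatAt N (fun y => fderiv ℂ h y v) x

section

variable {E : Type*} [NormedAddCommGroup E] [NormedSpace ℂ E]

theorem FlatAt.apply_eq_zero {N : ℕ} {h : E → V} {x : E} (hh : FlatAt N h x) : h x = 0 := by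
  cases N with
  | zero => exact hh
  | succ N => exact hh.1

theorem FlatAt.of_succ {N : ℕ} {h : E → V} {x : E} (hh : FlatAt (N + 1) h x) : FlatAt N h x := by
  induction N generalizing h with
  | zero => exact hh.1
  | succ N ih => exact ⟨hh.1, fun v => ih (hh.2 v)⟩

theorem contDiff_fderiv_const {h : E → V} (hh : ContDiff ℂ ∞ h) (v : E) :
    ContDiff ℂ ∞ fun y => fderiv ℂ h y v :=
  contDiff_fderiv_apply hh contDiff_const

theorem FlatAt.sum {κ : Type*} (s : Finset κ) {N : ℕ} {h : κ → E → V} {x : E}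
    (hs : ∀ i ∈ s, ContDiff ℂ ∞ (h i)) (hh : ∀ i ∈ s, FlatAt N (h i) x) :
    FlatAt N (fun y => ∑ i ∈ s, h i y) x := by
  induction N generalizing h with
  | zero => exact Finset.sum_eq_zero hh
  | succ N ih =>
    refine ⟨Finset.sum_eq_zero fun i hi => (hh i hi).1, fun v => ?_⟩
    have : (fun y => fderiv ℂ (fun y => ∑ i ∈ s, h i y) y v) =
        fun y => ∑ i ∈ s, fderiv ℂ (h i) y v := by
      ext1 y
      rw [fderiv_fun_sum fun i hi => (hs i hi).differentiable (by simp) y, sum_apply]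
    rw [this]
    exact ih (fun i hi => contDiff_fderiv_const (hs i hi) v) fun i hi => (hh i hi).2 v

theorem FlatAt.smul {N : ℕ} {a : E → ℂ} {h : E → V} {x : E} (ha : ContDiff ℂ ∞ a)
    (hs : ContDiff ℂ ∞ h) (hh : FlatAt N h x) : FlatAt N (fun y => a y • h y) x := by
  induction N generalizing a h with
  | zero => exact (congrArg (a x • ·) hh).trans (smul_zero _)
  | succ N ih =>
    refine ⟨(congrArg (a x • ·) hh.1).trans (smul_zero _), fun v => ?_⟩
    have : (fun y => fderiv ℂ (fun y => a y • h y) y v) = fun y => ∑ i : Fin 2,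
        (![fun y => a y • fderiv ℂ h y v, fun y => fderiv ℂ a y v • h y] i) y := by
      ext1 y
      rw [fderiv_fun_smul (ha.differentiable (by simp) y) (hs.differentiable (by simp) y)]
      simp
    rw [this]
    refine FlatAt.sum _ (fun i _ => ?_) fun i _ => ?_
    · fin_cases i
      · exact ha.smul (contDiff_fderiv_const hs v)
      · exact (contDiff_fderiv_const ha v).smul hs
    · fin_cases i
      · exact ih ha (contDiff_fderiv_const hs v) (hh.2 v)
      · exact ih (contDiff_fderiv_const ha v) hs hh.of_succ

end

theorem fderiv_apply_eq_sum [DecidableEq ι] (h : (ι → ℂ) → V) (y v : ι → ℂ) :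
    fderiv ℂ h y v = ∑ j, v j • fderiv ℂ h y (Pi.single j 1) := by
  conv_lhs => rw [pi_eq_sum_univ' v, map_sum]
  simp only [map_smul]

/-- In coordinates a Lie derivative is a combination of constant-direction derivatives with smooth
coefficients, so it costs exactly one order of flatness. -/
theorem FlatAt.fderiv_apply {N : ℕ} {h : (ι → ℂ) → V} {x : ι → ℂ} {X : (ι → ℂ) → ι → ℂ}
    (hs : ContDiff ℂ ∞ h) (hX : ContDiff ℂ ∞ X) (hh : FlatAt (N + 1) h x) :
    FlatAt N (fun y => fderiv ℂ h y (X y)) x := by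
  classical
  simp only [fderiv_apply_eq_sum h _ (X _)]
  have hXj : ∀ j, ContDiff ℂ ∞ fun y => X y j := contDiff_pi.mp hX
  exact FlatAt.sum _ (fun j _ => (hXj j).smul (contDiff_fderiv_const hs _))
    fun j _ => (hh.2 _).smul (hXj j) (contDiff_fderiv_const hs _)

theorem FlatAt.comp {E : Type*} [NormedAddCommGroup E] [NormedSpace ℂ E] {N : ℕ}
    {h : (ι → ℂ) → V} {φ : E → ι → ℂ} {x : E} (hs : ContDiff ℂ ∞ h) (hφ : ContDiff ℂ ∞ φ)
    (hh : FlatAt N h (φ x)) : FlatAt N (fun y => h (φ y)) x := by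
  classical
  induction N generalizing h with
  | zero => exact hh
  | succ N ih =>
    refine ⟨hh.1, fun v => ?_⟩
    have : (fun y => fderiv ℂ (fun y => h (φ y)) y v) =
        fun y => ∑ j, fderiv ℂ φ y v j • fderiv ℂ h (φ y) (Pi.single j 1) := by
      ext1 y
      rw [← fderiv_apply_eq_sum]
      exact congrArg (fun L : E →L[ℂ] V => L v) (fderiv_comp y
        (hs.differentiable (by simp) (φ y)) (hφ.differentiable (by simp) y))
    rw [this]
    have hφj : ∀ j, ContDiff ℂ ∞ fun y => fderiv ℂ φ y v j :=
      contDiff_pi.mp (contDiff_fderiv_const hφ v)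
    exact FlatAt.sum _ (fun j _ => (hφj j).smul ((contDiff_fderiv_const hs _).comp hφ))
      fun j _ => (ih (contDiff_fderiv_const hs _) (hh.2 _)).smul (hφj j)
        ((contDiff_fderiv_const hs _).comp hφ)

theorem FlatAt.lieWord {A : Type*} {f : A → (ι → ℂ) → ι → ℂ} (hf : ∀ ℓ, ContDiff ℂ ∞ (f ℓ))
    {h : (ι → ℂ) → V} {x : ι → ℂ} (hs : ContDiff ℂ ∞ h) (w : List A) {N : ℕ}
    (hh : FlatAt (N + w.length) h x) : FlatAt N (lieWord f w h) x := by
  induction w generalizing N with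
  | nil => exact hh
  | cons ℓ w ih =>
    rw [List.length_cons, ← add_assoc, add_right_comm] at hh
    exact (ih hh).fderiv_apply (contDiff_lieWord hf w hs) (hf ℓ)

end Flatness

/-! ### Taylor polynomials -/

section Taylor

variable {E V : Type*} [NormedAddCommGroup E] [NormedSpace ℂ E] [NormedAddCommGroup V]
  [NormedSpace ℂ V]

theorem iteratedFDeriv_succ_apply_last {h : E → V} (hh : ContDiff ℂ ∞ h) {k : ℕ} (x : E)
    (m : Fin (k + 1) → E) :
    iteratedFDeriv ℂ (k + 1) h x m =
      iteratedFDeriv ℂ k (fun y => fderiv ℂ h y (m (Fin.last k))) x (Fin.init m) := by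
  rw [iteratedFDeriv_succ_apply_right]
  have h1 : ContDiffAt ℂ ∞ (fderiv ℂ h) x := (hh.fderiv_right (m := ∞) (by simp)).contDiffAt
  have := (ContinuousLinearMap.apply ℂ V (m (Fin.last k))).iteratedFDeriv_comp_left h1
    (i := k) (by exact_mod_cast le_top)
  exact (congrArg (fun M : ContinuousMultilinearMap ℂ (fun _ : Fin k => E) V => M (Fin.init m))
    this).symm

theorem fderiv_fderiv_comm {h : E → V} (hh : ContDiff ℂ ∞ h) (v v' : E) :
    (fun y => fderiv ℂ (fun y => fderiv ℂ h y v) y v') =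
      fun y => fderiv ℂ (fun y => fderiv ℂ h y v') y v := by
  ext1 y
  have hsymm : IsSymmSndFDerivAt ℂ h y :=
    hh.contDiffAt.isSymmSndFDerivAt (by
      rw [minSmoothness_of_isRCLikeNormedField]
      exact WithTop.coe_le_coe.mpr (le_top : (2 : ℕ∞) ≤ ⊤))
  have hd : DifferentiableAt ℂ (fderiv ℂ h) y :=
    (hh.fderiv_right (m := ∞) (by simp)).differentiable (by simp) y
  have key : ∀ a b : E, fderiv ℂ (fun y => fderiv ℂ h y a) y b = fderiv ℂ (fderiv ℂ h) y b a := by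
    intro a b
    rw [fderiv_clm_apply hd (differentiableAt_const a)]
    simp
  rw [key, key, hsymm.eq]

/-- Symmetry of second derivatives makes the slot of `v` irrelevant. Differentiating a Taylor term
thus gives k + 1 equal summands, which cancel against the factorial. -/
theorem iteratedFDeriv_update_const {h : E → V} (hh : ContDiff ℂ ∞ h) {k : ℕ} (x z v : E)
    (i : Fin (k + 1)) :
    iteratedFDeriv ℂ (k + 1) h x (Function.update (fun _ => z) i v) =
      iteratedFDeriv ℂ k (fun y => fderiv ℂ h y v) x (fun _ => z) := by
  induction k generalizing h with
  | zero =>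
    obtain rfl : i = Fin.last 0 := Fin.ext (by simp)
    rw [iteratedFDeriv_succ_apply_last hh, Function.update_self]
    congr 1
    exact Subsingleton.elim _ _
  | succ k ih =>
    rw [iteratedFDeriv_succ_apply_last hh]
    induction i using Fin.lastCases with
    | last =>
      rw [Function.update_self, Fin.init_update_last]
      rfl
    | cast i =>
      rw [Function.update_of_ne (Fin.castSucc_lt_last i).ne', Fin.init_update_castSucc,
        show Fin.init (fun _ : Fin (k + 1 + 1) => z) = fun _ => z from rfl,
        ih (contDiff_fderiv_const hh z), fderiv_fderiv_comm hh,
        iteratedFDeriv_succ_apply_last (contDiff_fderiv_const hh v)]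
      rfl

/-- The Taylor polynomial of degree `N` of `h` at `x₀`. -/
noncomputable def taylorPoly (N : ℕ) (h : E → V) (x₀ y : E) : V :=
  ∑ k ∈ Finset.range (N + 1), ((Nat.factorial k : ℂ))⁻¹ •
    iteratedFDeriv ℂ k h x₀ (fun _ => y - x₀)

theorem contDiff_taylorPoly (N : ℕ) (h : E → V) (x₀ : E) :
    ContDiff ℂ ∞ (taylorPoly N h x₀) := by
  refine ContDiff.sum fun k _ => ContDiff.const_smul _ ?_
  exact (ContinuousMultilinearMap.contDiff _).comp
    (contDiff_pi.mpr fun _ => contDiff_id.sub contDiff_const)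

theorem taylorPoly_self (N : ℕ) (h : E → V) (x₀ : E) : taylorPoly N h x₀ x₀ = h x₀ := by
  rw [taylorPoly, Finset.sum_eq_single 0]
  · simp
  · intro k _ hk
    rw [ContinuousMultilinearMap.map_coord_zero _ (⟨0, Nat.pos_of_ne_zero hk⟩ : Fin k) (sub_self _),
      smul_zero]
  · simp

theorem fderiv_taylorPoly_succ {h : E → V} (hh : ContDiff ℂ ∞ h) (N : ℕ) (x₀ y v : E) :
    fderiv ℂ (taylorPoly (N + 1) h x₀) y v = taylorPoly N (fun y => fderiv ℂ h y v) x₀ y := by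
  classical
  have hterm : ∀ k, HasFDerivAt (fun y => iteratedFDeriv ℂ k h x₀ (fun _ => y - x₀))
      (((iteratedFDeriv ℂ k h x₀).linearDeriv fun _ => y - x₀).comp
        (ContinuousLinearMap.pi fun _ => ContinuousLinearMap.id ℂ E)) y := fun k =>
    ((iteratedFDeriv ℂ k h x₀).hasFDerivAt _).comp y
      (hasFDerivAt_pi.mpr fun _ => (hasFDerivAt_id y).sub_const x₀)
  have hsum : HasFDerivAt (taylorPoly (N + 1) h x₀) _ y :=
    HasFDerivAt.fun_sum fun k _ => (hterm k).const_smul ((Nat.factorial k : ℂ))⁻¹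
  rw [hsum.fderiv, sum_apply, Finset.sum_range_succ', taylorPoly]
  simp only [smul_apply, ContinuousLinearMap.comp_apply,
    ContinuousMultilinearMap.linearDeriv_apply, ContinuousLinearMap.pi_apply,
    ContinuousLinearMap.id_apply, iteratedFDeriv_update_const hh]
  rw [Finset.univ_eq_empty, Finset.sum_empty, smul_zero, add_zero]
  refine Finset.sum_congr rfl fun k _ => ?_
  rw [Finset.sum_const, Finset.card_univ, Fintype.card_fin, ← Nat.cast_smul_eq_nsmul ℂ, smul_smul,
    Nat.factorial_succ]
  congr 1
  have : ((k : ℂ) + 1) ≠ 0 := by exact_mod_cast k.succ_ne_zero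
  push_cast
  field_simp

/-- A directional derivative of the remainder is the remainder, one order lower, of the directional
derivative. -/
theorem flatAt_sub_taylorPoly {h : E → V} (hh : ContDiff ℂ ∞ h) (N : ℕ) (x₀ : E) :
    FlatAt N (fun y => h y - taylorPoly N h x₀ y) x₀ := by
  induction N generalizing h with
  | zero => exact sub_eq_zero.mpr (taylorPoly_self 0 h x₀).symm
  | succ N ih =>
    refine ⟨sub_eq_zero.mpr (taylorPoly_self _ h x₀).symm, fun v => ?_⟩
    have : (fun y => fderiv ℂ (fun y => h y - taylorPoly (N + 1) h x₀ y) y v) =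
        fun y => fderiv ℂ h y v - taylorPoly N (fun y => fderiv ℂ h y v) x₀ y := by
      ext1 y
      rw [fderiv_fun_sub (hh.differentiable (by simp) y)
        ((contDiff_taylorPoly _ h x₀).differentiable (by simp) y), sub_apply,
        fderiv_taylorPoly_succ hh]
    rw [this]
    exact ih (contDiff_fderiv_const hh v)

end Taylor

/-! ### Substituting a multiplicative series into a smooth map -/

section Substitution

variable {A : Type*} {ι : Type*} [Fintype ι] {V : Type*} [NormedAddCommGroup V] [NormedSpace ℂ V]
  {f : A → (ι → ℂ) → ι → ℂ} {β : List A → ℂ}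

/-- The coefficients of the formal series `∑_w β_w f_w(h)`, for vector-valued `h`. -/
noncomputable def lieCoeff (f : A → (ι → ℂ) → ι → ℂ) (β : List A → ℂ) (h : (ι → ℂ) → V)
    (m : A →₀ ℕ) (x : ι → ℂ) : V :=
  ∑ w ∈ wordsOfContent m, β w • lieWord f w h x

theorem contDiff_lieCoeff (hf : ∀ ℓ, ContDiff ℂ ∞ (f ℓ)) (β : List A → ℂ) {h : (ι → ℂ) → V}
    (hh : ContDiff ℂ ∞ h) (m : A →₀ ℕ) : ContDiff ℂ ∞ (lieCoeff f β h m) :=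
  ContDiff.sum fun w _ => (contDiff_lieWord hf w hh).const_smul (β w)

theorem lieCoeff_zero (hβ : β [] = 1) (h : (ι → ℂ) → V) (x : ι → ℂ) :
    lieCoeff f β h 0 x = h x := by
  rw [lieCoeff, wordsOfContent_zero, Finset.sum_singleton, hβ, one_smul, lieWord_nil]

theorem lieCoeff_sum (hf : ∀ ℓ, ContDiff ℂ ∞ (f ℓ)) {κ : Type*} (s : Finset κ)
    {h : κ → (ι → ℂ) → V} (hh : ∀ i ∈ s, ContDiff ℂ ∞ (h i)) (m : A →₀ ℕ) (x : ι → ℂ) :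
    lieCoeff f β (fun y => ∑ i ∈ s, h i y) m x = ∑ i ∈ s, lieCoeff f β (h i) m x := by
  simp only [lieCoeff, lieWord_sum hf s hh, Finset.smul_sum]
  exact Finset.sum_comm

theorem lieCoeff_add (hf : ∀ ℓ, ContDiff ℂ ∞ (f ℓ)) {h k : (ι → ℂ) → V} (hh : ContDiff ℂ ∞ h)
    (hk : ContDiff ℂ ∞ k) (m : A →₀ ℕ) (x : ι → ℂ) :
    lieCoeff f β (fun y => h y + k y) m x = lieCoeff f β h m x + lieCoeff f β k m x := by
  simp only [lieCoeff, lieWord_add hf hh hk, smul_add, Finset.sum_add_distrib]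

theorem lieCoeff_clm_comp (hf : ∀ ℓ, ContDiff ℂ ∞ (f ℓ)) {V' : Type*} [NormedAddCommGroup V']
    [NormedSpace ℂ V'] (T : V →L[ℂ] V') {h : (ι → ℂ) → V} (hh : ContDiff ℂ ∞ h) (m : A →₀ ℕ)
    (x : ι → ℂ) : lieCoeff f β (fun y => T (h y)) m x = T (lieCoeff f β h m x) := by
  simp only [lieCoeff, lieWord_clm_comp hf T hh, map_sum, map_smul]

theorem lieCoeff_const_smul (hf : ∀ ℓ, ContDiff ℂ ∞ (f ℓ)) (c : ℂ) {h : (ι → ℂ) → V}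
    (hh : ContDiff ℂ ∞ h) (m : A →₀ ℕ) (x : ι → ℂ) :
    lieCoeff f β (fun y => c • h y) m x = c • lieCoeff f β h m x :=
  lieCoeff_clm_comp hf (c • ContinuousLinearMap.id ℂ V) hh m x

theorem lieCoeff_const {m : A →₀ ℕ} (hm : m ≠ 0) (c : V) (x : ι → ℂ) :
    lieCoeff f β (fun _ => c) m x = 0 := by
  refine Finset.sum_eq_zero fun w hw => ?_
  rw [lieWord_const, smul_zero]
  rintro rfl
  exact hm (nil_mem_wordsOfContent_iff.mp hw)

theorem coeff_lieSeries_eq_lieCoeff (h : (ι → ℂ) → ℂ) (m : A →₀ ℕ) (x : ι → ℂ) :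
    MvPowerSeries.coeff m (lieSeries f β h x) = lieCoeff f β h m x :=
  Finset.sum_congr rfl fun _ _ => mul_comm _ _

/-- A word of content `m` has |m| letters and so differentiates at most |m| times. -/
theorem lieCoeff_of_flatAt (hf : ∀ ℓ, ContDiff ℂ ∞ (f ℓ)) {h : (ι → ℂ) → V}
    (hh : ContDiff ℂ ∞ h) {m : A →₀ ℕ} {x : ι → ℂ} (hx : FlatAt m.degree h x) :
    lieCoeff f β h m x = 0 := by
  refine Finset.sum_eq_zero fun w hw => ?_
  have : FlatAt (0 + w.length) h x := by rwa [zero_add, length_of_mem_wordsOfContent hw]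
  rw [(this.lieWord hf hh w).apply_eq_zero, smul_zero]

/-- The word series with coefficients `β` acts multiplicatively on scalar functions. -/
def IsMultiplicative (f : A → (ι → ℂ) → ι → ℂ) (β : List A → ℂ) : Prop :=
  ∀ (x : ι → ℂ) (a b : (ι → ℂ) → ℂ), ContDiff ℂ ∞ a → ContDiff ℂ ∞ b →
    lieSeries f β (fun y => a y * b y) x = lieSeries f β a x * lieSeries f β b x

theorem lieSeries_one (hβ : β [] = 1) (x : ι → ℂ) : lieSeries f β (fun _ => 1) x = 1 := by
  classical
  ext m
  rw [coeff_lieSeries_eq_lieCoeff, MvPowerSeries.coeff_one]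
  split_ifs with hm
  · rw [hm, lieCoeff_zero hβ]
  · exact lieCoeff_const hm 1 x

theorem lieSeries_prod (hβ : β [] = 1) (hmul : IsMultiplicative f β) {κ : Type*} (s : Finset κ)
    {a : κ → (ι → ℂ) → ℂ} (ha : ∀ i, ContDiff ℂ ∞ (a i)) (x : ι → ℂ) :
    lieSeries f β (fun y => ∏ i ∈ s, a i y) x = ∏ i ∈ s, lieSeries f β (a i) x := by
  classical
  induction s using Finset.induction_on with
  | empty => simpa using lieSeries_one hβ x
  | insert i s hi ih =>
    simp only [Finset.prod_insert hi]
    rw [hmul x _ _ (ha i) (contDiff_prod fun i _ => ha i), ih]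

open Classical in
theorem lieCoeff_prod (hβ : β [] = 1) (hmul : IsMultiplicative f β) {k : ℕ}
    {a : Fin k → (ι → ℂ) → ℂ} (ha : ∀ i, ContDiff ℂ ∞ (a i)) (p : A →₀ ℕ) (x : ι → ℂ) :
    lieCoeff f β (fun y => ∏ i, a i y) p x =
      ∑ q ∈ Finset.piAntidiag (Finset.univ : Finset (Fin k)) p,
        ∏ i, lieCoeff f β (a i) (q i) x := by
  rw [← coeff_lieSeries_eq_lieCoeff, lieSeries_prod hβ hmul _ ha, MvPowerSeries.coeff_prod]
  refine Finset.sum_bij (fun q _ => q) (fun q hq => ?_) (fun q _ q' _ h => DFunLike.coe_injective h)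
    (fun q hq => ?_) (fun q _ => ?_)
  · simpa using hq
  · refine ⟨Finsupp.equivFunOnFinite.symm q, ?_, ?_⟩
    · simpa using hq
    · simp
  · simp only [coeff_lieSeries_eq_lieCoeff]

-- Expanding `M` in the standard basis reduces the claim to products of scalar coordinate functions,
-- where multiplicativity applies.
open Classical in
theorem lieCoeff_multilinear (hf : ∀ ℓ, ContDiff ℂ ∞ (f ℓ)) (hβ : β [] = 1)
    (hmul : IsMultiplicative f β) {κ : Type*} [Fintype κ] {k : ℕ}
    (M : ContinuousMultilinearMap ℂ (fun _ : Fin k => κ → ℂ) V) {h : (ι → ℂ) → κ → ℂ}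
    (hh : ContDiff ℂ ∞ h) (p : A →₀ ℕ) (x : ι → ℂ) :
    lieCoeff f β (fun y => M fun _ => h y) p x =
      ∑ q ∈ Finset.piAntidiag (Finset.univ : Finset (Fin k)) p,
        M fun i => lieCoeff f β h (q i) x := by
  have hM : ∀ v : Fin k → κ → ℂ, M v = ∑ j : Fin k → κ, (∏ i, v i (j i)) •
      M (fun i => Pi.single (j i) 1) := by
    intro v
    have hv : v = fun i => ∑ j, v i j • (Pi.single j 1 : κ → ℂ) := by
      ext1 i
      exact pi_eq_sum_univ' (v i)
    conv_lhs => rw [hv]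
    rw [ContinuousMultilinearMap.map_sum]
    exact Finset.sum_congr rfl fun j _ => M.map_smul_univ _ _
  have hhj : ∀ j, ContDiff ℂ ∞ fun y => h y j := contDiff_pi.mp hh
  have hcoord : ∀ (q : A →₀ ℕ) (j : κ), lieCoeff f β h q x j = lieCoeff f β (fun y => h y j) q x :=
    fun q j => (lieCoeff_clm_comp hf (ContinuousLinearMap.proj j) hh q x).symm
  have hs : ∀ j : Fin k → κ, ContDiff ℂ ∞ fun y =>
      (∏ i, h y (j i)) • M fun i => Pi.single (j i) 1 := fun j =>
    (contDiff_prod fun i _ => hhj (j i)).smul contDiff_const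
  rw [funext fun y => hM fun _ => h y, Finset.sum_congr rfl fun q _ => hM _,
    lieCoeff_sum hf _ fun j _ => hs j,
    Finset.sum_comm]
  refine Finset.sum_congr rfl fun j _ => ?_
  have := lieCoeff_clm_comp (β := β) hf
    ((ContinuousLinearMap.id ℂ ℂ).smulRight (M fun i => Pi.single (j i) 1))
    (contDiff_prod fun i _ => hhj (j i) : ContDiff ℂ ∞ fun y => ∏ i, h y (j i)) p x
  refine this.trans ?_
  rw [lieCoeff_prod hβ hmul fun i => hhj (j i)]
  simp only [ContinuousLinearMap.smulRight_apply, ContinuousLinearMap.id_apply, Finset.sum_smul,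
    hcoord]

open Classical in
/-- Substituting the series `∑_w β_w f_w(φ)` into the Taylor expansion of `χ` at `φ(x)` gives the
series `∑_w β_w f_w(χ ∘ φ)`. -/
theorem taylor_substitution (hf : ∀ ℓ, ContDiff ℂ ∞ (f ℓ)) (hβ : β [] = 1)
    (hmul : IsMultiplicative f β) {κ : Type*} [Fintype κ] {χ : (κ → ℂ) → V}
    {φ : (ι → ℂ) → κ → ℂ} (hχ : ContDiff ℂ ∞ χ) (hφ : ContDiff ℂ ∞ φ) (p : A →₀ ℕ) (x : ι → ℂ) :
    ∑ k ∈ Finset.range (p.degree + 1), ((Nat.factorial k : ℂ))⁻¹ •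
      ∑ q ∈ (Finset.piAntidiag (Finset.univ : Finset (Fin k)) p).filter (fun q => ∀ i, q i ≠ 0),
        iteratedFDeriv ℂ k χ (φ x) (fun i => lieCoeff f β φ (q i) x) =
      lieCoeff f β (fun y => χ (φ y)) p x := by
  set T := taylorPoly p.degree χ (φ x) with hT
  have hTs : ContDiff ℂ ∞ T := contDiff_taylorPoly _ _ _
  -- The Taylor remainder is too flat at `x` to reach multidegree `p`; what is left is multilinear
  -- in φ(y) - φ(x), with base point φ(x) frozen.
  have hsplit : (fun y => χ (φ y)) = fun y => (χ (φ y) - T (φ y)) + T (φ y) := by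
    ext1 y
    rw [sub_add_cancel]
  have hrem : ContDiff ℂ ∞ fun z => χ z - T z := hχ.sub hTs
  have hψ : ContDiff ℂ ∞ fun y => φ y - φ x := hφ.sub contDiff_const
  have hterm : ∀ k, ContDiff ℂ ∞ fun y => iteratedFDeriv ℂ k χ (φ x) fun _ => φ y - φ x :=
    fun k => (ContinuousMultilinearMap.contDiff _).comp (contDiff_pi.mpr fun _ => hψ)
  have hremφ : ContDiff ℂ ∞ fun y => χ (φ y) - T (φ y) := hrem.comp hφ
  have hTφ : ContDiff ℂ ∞ fun y => T (φ y) := hTs.comp hφ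
  rw [hsplit, lieCoeff_add hf hremφ hTφ, lieCoeff_of_flatAt hf hremφ
    ((flatAt_sub_taylorPoly hχ p.degree (φ x)).comp hrem hφ),
    zero_add]
  simp only [hT, taylorPoly]
  rw [lieCoeff_sum hf _ fun k _ => (hterm k).const_smul _]
  refine Finset.sum_congr rfl fun k _ => ?_
  rw [lieCoeff_const_smul hf _ (hterm k), lieCoeff_multilinear hf hβ hmul _ hψ]
  congr 1
  rw [Finset.sum_filter]
  refine Finset.sum_congr rfl fun q _ => ?_
  have hψ' : ∀ m : A →₀ ℕ, m ≠ 0 →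
      lieCoeff f β (fun y => φ y - φ x) m x = lieCoeff f β φ m x := by
    intro m hm
    simp only [sub_eq_add_neg]
    rw [lieCoeff_add hf hφ contDiff_const, lieCoeff_const hm, add_zero]
  split_ifs with hq
  · congr 1
    ext1 i
    rw [hψ' _ (hq i)]
  -- A zero entry of `q` selects the degree-zero coefficient of φ(y) - φ(x) at y = x, which
  -- vanishes; this explains the filter on `q`.
  · push Not at hq
    obtain ⟨i, hi⟩ := hq
    rw [ContinuousMultilinearMap.map_coord_zero _ i]
    rw [hi, lieCoeff_zero hβ, sub_self]

end Substitution

/-! ### Φ as a Lie series and the group law -/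

section GroupLaw

variable {A : Type*} {D d : ℕ}
  {g : Fin d → (Fin D → ℂ) → (Fin D → ℂ)} {f : A → (Fin D → ℂ) → (Fin D → ℂ)}
  {ν : Fin d → A → ℂ} {v : Fin d → ℂ}

theorem wordSeries_eq_lieCoeff (β : List A → ℂ) : wordSeries f β = lieCoeff f β id := by
  ext1 m
  ext1 x
  simp only [wordSeries, lieCoeff, wordBasis_eq_lieWord]

/-- An ordinary map contributes only its degree-zero term to the composition, and substitution with
inner map `id` then applies. -/
theorem Phi_eq_lieCoeff [AddCommMonoid A] (hadd : ∀ j ℓ ℓ', ν j (ℓ + ℓ') = ν j ℓ + ν j ℓ')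
    (hnonres : ∀ ℓ, eigenvalue ν v ℓ = 0 ↔ ℓ = 0) (hf : ∀ ℓ, ContDiff ℂ ∞ (f ℓ)) (τ : ℝ)
    {u : Fin d → ℂ} (hφ : ContDiff ℂ ∞ (timeOneMap (linComb g u))) :
    Phi g f ν v τ u = lieCoeff f (gamma ν v τ u) (timeOneMap (linComb g u)) := by
  classical
  ext1 m
  ext1 x
  rw [Phi, FormalMap.comp, wordSeries_eq_lieCoeff, Finset.sum_eq_single (0, m)]
  · simp only [lieCoeff_zero (gamma_nil ν v τ u)]
    have : (ofMap (timeOneMap (linComb g u)) (0 : A →₀ ℕ)) = timeOneMap (linComb g u) := by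
      ext1 y
      simp [ofMap]
    simp only [this]
    exact taylor_substitution hf (gamma_nil ν v τ u)
      (fun x a b ha hb => lieSeries_gamma_mul hadd hnonres hf τ u ha hb x) hφ contDiff_id m x
  · rintro ⟨n, p⟩ hnp hne
    have hn : n ≠ 0 := by
      rintro rfl
      rw [Finset.HasAntidiagonal.mem_antidiagonal] at hnp
      exact hne (by rw [← hnp, zero_add])
    have : ofMap (timeOneMap (linComb g u)) n = fun _ => 0 := by
      ext1 y
      simp [ofMap, hn]
    simp [this]
  · intro h
    exact absurd (Finset.HasAntidiagonal.mem_antidiagonal.mpr (zero_add m)) h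

/-- Iterated Lie derivatives along eigenvectors of `ad X` are transported by the flow of `X`. -/
theorem lieWord_comp_eq {E V : Type*} [NormedAddCommGroup E] [NormedSpace ℂ E]
    [NormedAddCommGroup V] [NormedSpace ℂ V] {f : A → E → E} (hf : ∀ ℓ, ContDiff ℂ ∞ (f ℓ))
    {φ : E → E} (hφ : ContDiff ℂ ∞ φ) {z : A → ℂ}
    (hz : ∀ ℓ x, f ℓ (φ x) = Complex.exp (z ℓ) • fderiv ℂ φ x (f ℓ x)) {h : E → V}
    (hh : ContDiff ℂ ∞ h) (w : List A) (x : E) :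
    lieWord f w h (φ x) = wordExp z w • lieWord f w (fun y => h (φ y)) x := by
  induction w generalizing x with
  | nil => simp [wordExp, lieWord_nil]
  | cons ℓ w ih =>
    have hw := contDiff_lieWord hf w hh
    have hw' := contDiff_lieWord hf w (hh.comp hφ)
    -- The same derivative is computed by the chain rule and by the induction hypothesis; `hz`
    -- contributes the exponential of the new letter.
    have h1 : fderiv ℂ (fun y => lieWord f w h (φ y)) x =
        (fderiv ℂ (lieWord f w h) (φ x)).comp (fderiv ℂ φ x) :=
      fderiv_comp x (hw.differentiable (by simp) _) (hφ.differentiable (by simp) x)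
    have h2 : fderiv ℂ (fun y => lieWord f w h (φ y)) x =
        wordExp z w • fderiv ℂ (lieWord f w fun y => h (φ y)) x := by
      rw [funext ih]
      exact fderiv_fun_const_smul (hw'.differentiable (by simp) x) _
    rw [lieWord_cons, lieWord_cons]
    beta_reduce
    rw [hz, map_smul, ← ContinuousLinearMap.comp_apply, ← h1, h2, smul_apply, smul_smul, wordExp,
      wordExp, ← Complex.exp_add, List.map_cons, List.sum_cons]

end GroupLaw

end WordSeries

theorem mainTheorem4 {D d : ℕ} {A : Type*} [AddCommMonoid A] [Countable A]
    (g : Fin d → (Fin D → ℂ) → (Fin D → ℂ))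
    (f : A → (Fin D → ℂ) → (Fin D → ℂ))
    (ν : Fin d → A → ℂ) (v : Fin d → ℂ)
    (hg : ∀ j, ContDiff ℂ ∞ (g j))
    (hf : ∀ ℓ, ContDiff ℂ ∞ (f ℓ))
    (hindep : LinearIndependent ℂ g)
    (hcomm : ∀ j k, VectorField.lieBracket ℂ (g j) (g k) = 0)
    (hcomplete : ∀ u : Fin d → ℂ, WordSeries.IsCompleteField (WordSeries.linComb g u))
    (heigen : ∀ j ℓ, VectorField.lieBracket ℂ (g j) (f ℓ) = ν j ℓ • f ℓ)
    (hadd : ∀ j ℓ ℓ', ν j (ℓ + ℓ') = ν j ℓ + ν j ℓ')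
    (hnonres : ∀ ℓ, WordSeries.eigenvalue ν v ℓ = 0 ↔ ℓ = 0) :
    (∀ (τ : ℝ) (u : Fin d → ℂ) (m : A →₀ ℕ), ContDiff ℂ ∞ (WordSeries.Phi g f ν v τ u m)) ∧
    ∀ (τ τ' : ℝ) (u u' : Fin d → ℂ),
      WordSeries.FormalMap.comp (WordSeries.Phi g f ν v τ u) (WordSeries.Phi g f ν v τ' u') =
        WordSeries.Phi g f ν v (τ + τ') (u + u') := by
  classical
  open WordSeries in
  have hφ : ∀ u, ContDiff ℂ ∞ (timeOneMap (linComb g u)) := fun u =>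
    contDiff_timeOneMap (contDiff_linComb hg u) (hcomplete u)
  have hPhi : ∀ τ u, Phi g f ν v τ u = lieCoeff f (gamma ν v τ u) (timeOneMap (linComb g u)) :=
    fun τ u => Phi_eq_lieCoeff hadd hnonres hf τ (hφ u)
  have hsmooth : ∀ τ u m, ContDiff ℂ ∞ (Phi g f ν v τ u m) := fun τ u m => by
    rw [hPhi]
    exact contDiff_lieCoeff hf _ (hφ u) m
  refine ⟨hsmooth, fun τ τ' u u' => ?_⟩
  -- The outer series is pulled back along φ_{u'}, which produces the exponential weights of the
  -- convolution identity and merges the two flows.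
  have htrans : ∀ n y, Phi g f ν v τ u n (timeOneMap (linComb g u') y) =
      ∑ w ∈ wordsOfContent n, (wordExp (eigenvalue ν u') w * gamma ν v τ u w) •
        lieWord f w (timeOneMap (linComb g (u + u'))) y := by
    intro n y
    rw [hPhi]
    refine Finset.sum_congr rfl fun w _ => ?_
    rw [lieWord_comp_eq hf (hφ u') (fun ℓ => apply_timeOneMap_of_lieBracket_eq
      (contDiff_linComb hg u') (hcomplete u') (hf ℓ)
      (lieBracket_linComb_left hg (fun j => heigen j ℓ) u')) (hφ u),
      funext (timeOneMap_linComb_add hg hcomm hcomplete u u'), smul_smul, mul_comm]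
    rfl
  ext1 m
  ext1 x
  have hG0 : Phi g f ν v τ' u' 0 x = timeOneMap (linComb g u') x := by
    rw [hPhi, lieCoeff_zero (gamma_nil ν v τ' u')]
  rw [FormalMap.comp, hPhi (τ + τ'), lieCoeff]
  simp only [gamma_add hadd hnonres, Finset.sum_smul, hG0]
  -- The prefix `w` comes from the inner series and the suffix `w'` from the outer one, since the
  -- inner Lie derivatives are applied last.
  have hsplit := sum_wordsOfContent_splits m fun w w' =>
    (gamma ν v τ' u' w * (wordExp (eigenvalue ν u') w' * gamma ν v τ u w')) •
      lieWord f (w ++ w') (timeOneMap (linComb g (u + u'))) x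
  simp only [List.take_append_drop] at hsplit
  rw [hsplit]
  refine Finset.sum_congr rfl fun np _ => ?_
  have hsub := taylor_substitution hf (gamma_nil ν v τ' u')
    (fun x a b ha hb => lieSeries_gamma_mul hadd hnonres hf τ' u' ha hb x)
    (hsmooth τ u np.1) (hφ u') np.2 x
  rw [hPhi τ' u']
  refine hsub.trans ?_
  rw [funext (htrans np.1)]
  have hs : ∀ w ∈ wordsOfContent np.1, ContDiff ℂ ∞ fun y =>
      (wordExp (eigenvalue ν u') w * gamma ν v τ u w) •
        lieWord f w (timeOneMap (linComb g (u + u'))) y := fun w _ =>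
    (contDiff_lieWord hf w (hφ _)).const_smul _
  rw [lieCoeff_sum hf _ hs, Finset.sum_comm]
  refine Finset.sum_congr rfl fun w _ => ?_
  rw [lieCoeff_const_smul hf _ (contDiff_lieWord hf w (hφ _)), lieCoeff, Finset.smul_sum]
  refine Finset.sum_congr rfl fun w' _ => ?_
  rw [lieWord_append, smul_smul, mul_comm]
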